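/- For an integer $R$ with $|R|>1$ and finite sets $D,L\subset\mathbb{Z}$ with $\#D=\#L$, call $(R,D,L)$ a Hadamard triple if the matrix $H=\frac{1}{\sqrt{\#D}}\left[e^{2\pi i d\ell/R}\right]_{\ell\in L,\,d\in D}$ satisfies $H^*H=I$. For a finite set $A\subset\mathbb{R}$ put $\delta_A=\frac1{\#A}\sum_{a\in A}\delta_a$. Given integers $p_n$ with $|p_n|>1$ and finite non-empty sets $\mathcal{D}_n\subset\mathbb{Z}$ ($n\ge1$), the Moran measure $\mu_{\{p_n,\mathcal{D}_n\}}$ is, if it exists, the Borel probability measure on $\mathbb{R}$ that is the weak limit of $\mu_n=\delta_{p_1^{-1}\mathcal{D}_1}*\delta_{(p_1p_2)^{-1}\mathcal{D}_2}*\cdots*\delta_{(p_1\cdots p_n)^{-1}\mathcal{D}_n}$, where the $\mu_n$ and the limit are all supported on one compact set. A Borel probability measure $\mu$ on $\mathbb{R}$ is called spectral if there is a countable set $\Lambda\subset\mathbb{R}$ such that $\{e^{2\pi i\lambda x}:\lambda\in\Lambda\}$ is an orthogonal basis of $L^2(\mu)$. **Proposition.** In each of the following two cases there are sets $L_n\subset\mathbb{Z}$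 such that $(p_n,\mathcal{D}_n,L_n)$ is a Hadamard triple for every $n\ge1$, one has $\sup_n\#\mathcal{D}_n<\infty$ and $\sup_n\{p_n^{-1}d:d\in\mathcal{D}_n\}=\infty$, and the Moran measure $\mu_{\{p_n,\mathcal{D}_n\}}$ exists. Moreover: (i) if $p_n=9$ and $\mathcal{D}_n=\{0,2,4^n\}$ for all $n\ge1$, then $\mu_{\{p_n,\mathcal{D}_n\}}$ is not a spectral measure; (ii) if $p_n=3n$ and $\mathcal{D}_n=\{0,2,3n^2+1\}$ for all $n\ge1$, then $\mu_{\{p_n,\mathcal{D}_n\}}$ is a spectral measure. -/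

import Mathlib

open MeasureTheory Filter Topology

noncomputable section

namespace CantorMoran

/-- `(R, D, L)` is a Hadamard triple on `ℝ`: `R` is an integer with `|R| > 1`, `D` and `L` are
finite sets of integers with the same number of elements, and the matrix
`H = (#D)^(-1/2) [exp (2 π i d ℓ / R)]`, with rows `ℓ ∈ L` and columns `d ∈ D`,
satisfies `H* H = I`. -/
def IsHadamardTriple (R : ℤ) (D L : Finset ℤ) : Prop :=
  1 < |R| ∧ D.card = L.card ∧
    let H : Matrix L D ℂ := Matrix.of fun l d =>
      ((1 / Real.sqrt (D.card : ℝ) : ℝ) : ℂ) *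
        Complex.exp (2 * Real.pi * Complex.I * (((d : ℤ) : ℂ) * ((l : ℤ) : ℂ) / (R : ℂ)))
    H.conjTranspose * H = 1

/-- The uniform measure `δ_A = (1/#A) ∑_{a ∈ A} δ_a` on a finite set `A` of reals. -/
def uniformMeasure (A : Finset ℝ) : Measure ℝ :=
  (A.card : ENNReal)⁻¹ • ∑ a ∈ A, Measure.dirac a

/-- The finite set `(p_1 p_2 ⋯ p_n)⁻¹ D_n`. Sequences are indexed by `n ≥ 1`. -/
def scaledDigits (p : ℕ → ℤ) (D : ℕ → Finset ℤ) (n : ℕ) : Finset ℝ :=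
  (D n).image fun d : ℤ => (d : ℝ) / ((∏ j ∈ Finset.Icc 1 n, p j : ℤ) : ℝ)

/-- The finite convolution
`μ_n = δ_{p_1⁻¹ D_1} ∗ δ_{(p_1 p_2)⁻¹ D_2} ∗ ⋯ ∗ δ_{(p_1 ⋯ p_n)⁻¹ D_n}`
(with `μ_0 = δ_0`, the neutral element of convolution). -/
def partialMoran (p : ℕ → ℤ) (D : ℕ → Finset ℤ) : ℕ → Measure ℝ
  | 0 => Measure.dirac 0
  | n + 1 => (partialMoran p D n).conv (uniformMeasure (scaledDigits p D (n + 1)))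

/-- `μ` is the Moran measure of the sequence `(p_n, D_n)_{n ≥ 1}`: a Borel probability measure on
the line, the weak limit of the finite convolutions `μ_n`, all of these measures being supported
on one compact set `T`. -/
def IsMoranMeasure (p : ℕ → ℤ) (D : ℕ → Finset ℤ) (μ : ProbabilityMeasure ℝ) : Prop :=
  (∃ T : Set ℝ, IsCompact T ∧ (μ : Measure ℝ) Tᶜ = 0 ∧ ∀ n, 1 ≤ n → partialMoran p D n Tᶜ = 0) ∧
  ∀ f : ℝ → ℝ, Continuous f → HasCompactSupport f →
    Tendsto (fun n => ∫ x, f x ∂(partialMoran p D n)) atTop (𝓝 (∫ x, f x ∂(μ : Measure ℝ)))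

theorem memLp_exp (μ : ProbabilityMeasure ℝ) (t : ℝ) :
    MemLp (fun x : ℝ => Complex.exp (2 * Real.pi * Complex.I * (t * x))) 2 (μ : Measure ℝ) := by
  refine MemLp.of_bound (Continuous.aestronglyMeasurable (by fun_prop)) 1
    (Eventually.of_forall fun x => le_of_eq ?_)
  have h : (2 * Real.pi * Complex.I * (t * x) : ℂ)
      = ((2 * Real.pi * (t * x) : ℝ) : ℂ) * Complex.I := by
    push_cast; ring
  rw [h, Complex.norm_exp_ofReal_mul_I]

/-- The exponential `x ↦ exp (2 π i t x)` as an element of the complex Hilbert space `L²(μ)`. -/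
def expL2 (μ : ProbabilityMeasure ℝ) (t : ℝ) : Lp ℂ 2 (μ : Measure ℝ) :=
  (memLp_exp μ t).toLp _

/-- `Λ` is a spectrum of `μ`: it is countable and the family `exp (2 π i t x)`, `t ∈ Λ`, is an
orthogonal basis of `L²(μ)`, i.e. pairwise orthogonal with dense linear span. -/
def IsSpectrum (μ : ProbabilityMeasure ℝ) (Λ : Set ℝ) : Prop :=
  Λ.Countable ∧
  (∀ s ∈ Λ, ∀ t ∈ Λ, s ≠ t → inner ℂ (expL2 μ s) (expL2 μ t) = 0) ∧
  (Submodule.span ℂ (expL2 μ '' Λ)).topologicalClosure = ⊤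

/-- `μ` is a spectral measure: it has a spectrum. -/
def IsSpectralMeasure (μ : ProbabilityMeasure ℝ) : Prop :=
  ∃ Λ : Set ℝ, IsSpectrum μ Λ

/-- `sup_n {p_n⁻¹ d : d ∈ D_n} < ∞`, over `n ≥ 1`. -/
def BoundedDigits (p : ℕ → ℤ) (D : ℕ → Finset ℤ) : Prop :=
  BddAbove {x : ℝ | ∃ n : ℕ, 1 ≤ n ∧ ∃ d ∈ D n, x = (d : ℝ) / (p n : ℝ)}

/-- `(p_n, D_n)_{n ≥ 1}` extends to a sequence of Hadamard triples `(p_n, D_n, L_n)`,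
with `sup_n #D_n < ∞`. -/
def IsHadamardSequence (p : ℕ → ℤ) (D : ℕ → Finset ℤ) : Prop :=
  (∃ L : ℕ → Finset ℤ, ∀ n, 1 ≤ n → IsHadamardTriple (p n) (D n) (L n)) ∧
  ∃ C : ℕ, ∀ n, 1 ≤ n → (D n).card ≤ C

/-- `p_n = 9`. -/
def pA (_ : ℕ) : ℤ := 9

/-- `D_n = {0, 2, 4^n}`. -/
def DA (n : ℕ) : Finset ℤ := {0, 2, 4 ^ n}

/-- `p_n = 3 n`. -/
def pB (n : ℕ) : ℤ := 3 * n

/-- `D_n = {0, 2, 3 n² + 1}`. -/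
def DB (n : ℕ) : Finset ℤ := {0, 2, 3 * (n : ℤ) ^ 2 + 1}

end CantorMoran

end

noncomputable section

namespace CantorMoran

/-!
The Fourier transform of a Moran measure is the infinite product of the masks
`M_k(t) = (1/#D_k) ∑_{d ∈ D_k} exp (-2πi d t / (p_1 ⋯ p_k))`. By Parseval, orthogonal frequencies
`Λ` form a spectrum if and only if `∑_{λ ∈ Λ} |μ̂(ξ + λ)|² = 1` for every `ξ`.

For `p_n = 3n` the `n`-th partial convolution has as a spectrum the integers
`l_1 + p_1 l_2 + ⋯ + p_1 ⋯ p_{n-1} l_n` with `l_k ∈ L_k`. The products `p_1 ⋯ p_n` grow so fast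
that the remaining masks stay bounded below on these frequencies, so Parseval's identity passes to
the limit by dominated convergence.

For `p_n = 9` the zeros of `M_k` are the numbers `9^k j / 6` with `3 ∤ j`. Orthogonality therefore
leaves at most `3^N` frequencies in an interval of length about `9^N`, and a spectrum has
arbitrarily long gaps. With `-ξ` in the middle of a long gap all the frequencies `ξ + λ` are far
from `0`, and it remains to see that such frequencies carry total weight at most `1/2`.
In the layer `9^K / 36 < |t| ≤ 9^K / 4` the masks beyond `K` are governed by the orbit
`t (4/9)^i`. Each time this orbit is far from the integers a factor `ρ < 1` is gained. This
happens at least about `log log |t|` times. If it happens rarely then the integers nearest to the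
orbit form an almost geometric sequence, and such a sequence is determined by few parameters.
Truncating the orbits and applying Bessel's inequality to the first `K` masks, each such class of
frequencies has weight at most `ρ` to the number of far points. The number of classes is
polynomial in `K`, so summation over dyadic ranges of `K` converges.
-/

open scoped FourierTransform

theorem fourierChar_eq_one_iff {x : ℝ} : 𝐞 x = 1 ↔ ∃ n : ℤ, x = n := by
  rw [Real.fourierChar_apply', Circle.exp_eq_one]
  refine exists_congr fun n => ?_
  rw [mul_comm (n : ℝ), mul_right_inj' Real.two_pi_pos.ne']

theorem fourierChar_add_intCast (x : ℝ) (n : ℤ) : 𝐞 (x + n) = 𝐞 x := by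
  rw [AddChar.map_add_eq_mul, fourierChar_eq_one_iff.2 ⟨n, rfl⟩, mul_one]

theorem coe_fourierChar_neg (x : ℝ) : (𝐞 (-x) : ℂ) = starRingEnd ℂ (𝐞 x) := by
  rw [AddChar.map_neg_eq_inv, Circle.coe_inv_eq_conj]

theorem coe_fourierChar_add (x y : ℝ) : (𝐞 (x + y) : ℂ) = 𝐞 x * 𝐞 y := by
  rw [AddChar.map_add_eq_mul, Circle.coe_mul]

theorem coe_fourierChar_sub (x y : ℝ) : (𝐞 (x - y) : ℂ) = 𝐞 x * starRingEnd ℂ (𝐞 y) := by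
  rw [sub_eq_add_neg, coe_fourierChar_add, coe_fourierChar_neg]

theorem re_fourierChar (x : ℝ) : (𝐞 x : ℂ).re = Real.cos (2 * Real.pi * x) := by
  rw [Real.fourierChar_apply, Complex.exp_ofReal_mul_I_re]

theorem im_fourierChar (x : ℝ) : (𝐞 x : ℂ).im = Real.sin (2 * Real.pi * x) := by
  rw [Real.fourierChar_apply, Complex.exp_ofReal_mul_I_im]

theorem norm_fourierChar_sub_one_le (x : ℝ) : ‖(𝐞 x : ℂ) - 1‖ ≤ 2 * Real.pi * |x| := by
  have h := Real.norm_exp_I_mul_ofReal_sub_one_le (x := 2 * Real.pi * x)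
  rwa [mul_comm Complex.I, ← Real.fourierChar_apply, Real.norm_eq_abs, abs_mul,
    abs_of_pos Real.two_pi_pos] at h

theorem sum_range_fourierChar_eq_zero {N : ℕ} {j : ℤ} (hN : N ≠ 0) (hj : ¬ (N : ℤ) ∣ j) :
    ∑ c ∈ Finset.range N, (𝐞 (c * (j / N)) : ℂ) = 0 := by
  have hN' : (N : ℝ) ≠ 0 := Nat.cast_ne_zero.2 hN
  have hpow (c : ℕ) : (𝐞 (c * ((j : ℝ) / N)) : ℂ) = (𝐞 ((j : ℝ) / N) : ℂ) ^ c := by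
    rw [← nsmul_eq_mul, AddChar.map_nsmul_eq_pow, Circle.coe_pow]
  have hne : (𝐞 ((j : ℝ) / N) : ℂ) ≠ 1 := by
    rw [Ne, Circle.coe_eq_one, fourierChar_eq_one_iff]
    rintro ⟨n, hn⟩
    rw [div_eq_iff hN'] at hn
    exact hj ⟨n, by rw [mul_comm]; exact_mod_cast hn⟩
  have hend : (𝐞 ((j : ℝ) / N) : ℂ) ^ N = 1 := by
    rw [← hpow, mul_div_cancel₀ _ hN', Circle.coe_eq_one, fourierChar_eq_one_iff]
    exact ⟨j, rfl⟩
  rw [Finset.sum_congr rfl fun c _ => hpow c, geom_sum_eq hne, hend, sub_self, zero_div]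

/-- The mask `M_D(x) = (#D)⁻¹ ∑_{d ∈ D} exp (2 π i d x)` of a finite set of integer digits; the
Fourier transform of a Moran measure is the product of the masks of its levels. -/
def mask (D : Finset ℤ) (x : ℝ) : ℂ := (∑ d ∈ D, (𝐞 (d * x) : ℂ)) / D.card

section Mask

variable {D : Finset ℤ}

theorem mask_zero (hD : D.Nonempty) : mask D 0 = 1 := by
  have h : (D.card : ℂ) ≠ 0 := Nat.cast_ne_zero.2 hD.card_ne_zero
  simp only [mask, mul_zero, AddChar.map_zero_eq_one, Circle.coe_one, Finset.sum_const,
    nsmul_eq_mul, mul_one, div_self h]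

theorem norm_mask_le_one (D : Finset ℤ) (x : ℝ) : ‖mask D x‖ ≤ 1 := by
  rw [mask, norm_div, Complex.norm_natCast]
  refine div_le_one_of_le₀ ((norm_sum_le _ _).trans_eq ?_) (Nat.cast_nonneg _)
  simp only [Circle.norm_coe, Finset.sum_const, nsmul_eq_mul, mul_one]

theorem mask_neg (D : Finset ℤ) (x : ℝ) : mask D (-x) = starRingEnd ℂ (mask D x) := by
  simp only [mask, mul_neg, coe_fourierChar_neg, map_div₀, map_sum, map_natCast]

theorem mask_add_intCast (D : Finset ℤ) (x : ℝ) (n : ℤ) : mask D (x + n) = mask D x := by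
  have h (d : ℤ) : 𝐞 (d * (x + n)) = 𝐞 (d * x) := by
    rw [mul_add, ← Int.cast_mul, fourierChar_add_intCast]
  simp only [mask, h]

theorem norm_mask_sub_one_le (hD : D.Nonempty) {x c : ℝ} (hx : ∀ d ∈ D, |d * x| ≤ c) :
    ‖mask D x - 1‖ ≤ 2 * Real.pi * c := by
  have hcard : (0 : ℝ) < D.card := Nat.cast_pos.2 hD.card_pos
  have hsub : mask D x - 1 = (∑ d ∈ D, ((𝐞 (d * x) : ℂ) - 1)) / D.card := by
    rw [mask, Finset.sum_sub_distrib, Finset.sum_const, nsmul_eq_mul, mul_one, sub_div,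
      div_self (Nat.cast_ne_zero.2 hD.card_ne_zero)]
  rw [hsub, norm_div, Complex.norm_natCast, div_le_iff₀ hcard]
  calc ‖∑ d ∈ D, ((𝐞 (d * x) : ℂ) - 1)‖ ≤ ∑ _d ∈ D, 2 * Real.pi * c :=
        norm_sum_le_of_le _ fun d hd => (norm_fourierChar_sub_one_le _).trans
          (mul_le_mul_of_nonneg_left (hx d hd) Real.two_pi_pos.le)
    _ = 2 * Real.pi * c * D.card := by rw [Finset.sum_const, nsmul_eq_mul, mul_comm]

end Mask

section TernaryMask

variable {a b : ℤ}

theorem mask_triple (ha : a ≠ 0) (hb : b ≠ 0) (hab : a ≠ b) (x : ℝ) :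
    mask {0, a, b} x = (1 + 𝐞 (a * x) + 𝐞 (b * x)) / 3 := by
  have h0 : (0 : ℤ) ∉ ({a, b} : Finset ℤ) := by simp [ha.symm, hb.symm]
  have hcard : ({0, a, b} : Finset ℤ).card = 3 := by
    rw [Finset.card_insert_of_notMem h0, Finset.card_pair hab]
  rw [mask, hcard, Finset.sum_insert h0, Finset.sum_pair hab]
  simp [add_assoc]

theorem cube_eq_one_of_one_add_add_eq_zero {z w : ℂ} (hz : ‖z‖ = 1) (hw : ‖w‖ = 1)
    (h : 1 + z + w = 0) : z ^ 3 = 1 ∧ z ≠ 1 := by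
  have hzz : z * starRingEnd ℂ z = 1 := by simp [Complex.mul_conj', hz]
  have hww : (1 + z) * (1 + starRingEnd ℂ z) = 1 := by
    have hw' : 1 + z = -w := by linear_combination h
    rw [← map_one (starRingEnd ℂ), ← map_add, map_one, hw', Complex.mul_conj', norm_neg, hw]
    simp
  have hpoly : z ^ 2 + z + 1 = 0 := by
    linear_combination z * hww - (z + 1) * hzz
  refine ⟨by linear_combination (z - 1) * hpoly, ?_⟩
  rintro rfl
  norm_num at hpoly

theorem exists_eq_div_three_of_mask_triple_eq_zero (ha : a ≠ 0) (hb : b ≠ 0) (hab : a ≠ b)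
    {x : ℝ} (h : mask {0, a, b} x = 0) : ∃ j : ℤ, ¬ (3 : ℤ) ∣ j ∧ a * x = j / 3 := by
  rw [mask_triple ha hb hab, div_eq_zero_iff, or_iff_left three_ne_zero] at h
  obtain ⟨hcube, hne⟩ :=
    cube_eq_one_of_one_add_add_eq_zero (Circle.norm_coe _) (Circle.norm_coe _) h
  have hthree : 𝐞 ((3 : ℕ) • (a * x)) = 1 := by
    rw [AddChar.map_nsmul_eq_pow, ← Circle.coe_eq_one, Circle.coe_pow, hcube]
  obtain ⟨j, hj⟩ := fourierChar_eq_one_iff.1 hthree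
  rw [nsmul_eq_mul, Nat.cast_ofNat] at hj
  refine ⟨j, ?_, by linarith⟩
  rintro ⟨m, rfl⟩
  refine hne (Circle.coe_eq_one.2 (fourierChar_eq_one_iff.2 ⟨m, ?_⟩))
  push_cast at hj
  linarith

end TernaryMask

section UniformMeasure

variable {A : Finset ℝ}

theorem isProbabilityMeasure_uniformMeasure (hA : A.Nonempty) :
    IsProbabilityMeasure (uniformMeasure A) := by
  refine ⟨?_⟩
  simp only [uniformMeasure, Measure.smul_apply, Measure.finsetSum_apply, measure_univ,
    Finset.sum_const, nsmul_eq_mul, mul_one, smul_eq_mul]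
  exact ENNReal.inv_mul_cancel (Nat.cast_ne_zero.2 hA.card_ne_zero) (ENNReal.natCast_ne_top _)

theorem ae_mem_uniformMeasure (A : Finset ℝ) : ∀ᵐ x ∂uniformMeasure A, x ∈ A := by
  refine Measure.ae_smul_measure ?_ _
  rw [ae_finsetSum_measure_iff]
  exact fun a ha => (ae_dirac_iff (p := (· ∈ A)) A.measurableSet).2 ha

theorem integral_uniformMeasure (A : Finset ℝ) (f : ℝ → ℂ) :
    ∫ x, f x ∂uniformMeasure A = (∑ a ∈ A, f a) / A.card := by
  rw [uniformMeasure, integral_smul_measure,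
    integral_finsetSum_measure fun a _ => integrable_dirac (by simp)]
  simp only [integral_dirac, Complex.real_smul, ENNReal.toReal_inv, ENNReal.toReal_natCast]
  push_cast
  rw [div_eq_inv_mul]

end UniformMeasure

/-- The product `p_1 p_2 ⋯ p_n`. -/
def moranProd (p : ℕ → ℤ) (n : ℕ) : ℤ := ∏ j ∈ Finset.Icc 1 n, p j

/-- The Fourier transform of the uniform measure on `(p_1 ⋯ p_k)⁻¹ D_k`, the `k`-th convolution
factor of a Moran measure. -/
def levelMask (p : ℕ → ℤ) (D : ℕ → Finset ℤ) (k : ℕ) (t : ℝ) : ℂ :=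
  mask (D k) (t / moranProd p k)

/-- The joint law of the independent uniform choices of a scaled digit at every level; the level
`k + 1` is the coordinate `k`. -/
def digitLaw (p : ℕ → ℤ) (D : ℕ → Finset ℤ) : Measure (ℕ → ℝ) :=
  Measure.infinitePi fun k => uniformMeasure (scaledDigits p D (k + 1))

section MoranMeasure

variable {p : ℕ → ℤ} {D : ℕ → Finset ℤ}

theorem scaledDigits_eq_image (p : ℕ → ℤ) (D : ℕ → Finset ℤ) (n : ℕ) :
    scaledDigits p D n = (D n).image fun d : ℤ => (d : ℝ) / moranProd p n := rfl

theorem moranProd_succ (p : ℕ → ℤ) (n : ℕ) : moranProd p (n + 1) = moranProd p n * p (n + 1) :=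
  Finset.prod_Icc_succ_top n.succ_pos _

theorem moranProd_ne_zero (hp : ∀ n, 1 ≤ n → p n ≠ 0) (n : ℕ) : moranProd p n ≠ 0 :=
  Finset.prod_ne_zero_iff.2 fun j hj => hp j (Finset.mem_Icc.1 hj).1

theorem norm_levelMask_le_one (p : ℕ → ℤ) (D : ℕ → Finset ℤ) (k : ℕ) (t : ℝ) :
    ‖levelMask p D k t‖ ≤ 1 := norm_mask_le_one _ _

theorem norm_levelMask_neg (p : ℕ → ℤ) (D : ℕ → Finset ℤ) (k : ℕ) (t : ℝ) :
    ‖levelMask p D k (-t)‖ = ‖levelMask p D k t‖ := by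
  rw [levelMask, neg_div, mask_neg, RCLike.norm_conj, levelMask]

section Existence

variable (hD : ∀ n, 1 ≤ n → (D n).Nonempty)
include hD

theorem isProbabilityMeasure_uniformMeasure_scaledDigits {n : ℕ} (hn : 1 ≤ n) :
    IsProbabilityMeasure (uniformMeasure (scaledDigits p D n)) :=
  isProbabilityMeasure_uniformMeasure ((hD n hn).image _)

theorem isProbabilityMeasure_partialMoran (n : ℕ) :
    IsProbabilityMeasure (partialMoran p D n) := by
  induction n with
  | zero => exact Measure.dirac.isProbabilityMeasure
  | succ n ih =>
    have := isProbabilityMeasure_uniformMeasure_scaledDigits (p := p) hD n.succ_pos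
    exact inferInstanceAs (IsProbabilityMeasure (_ ∗ _))

theorem isProbabilityMeasure_digitLaw : IsProbabilityMeasure (digitLaw p D) := by
  have (k : ℕ) := isProbabilityMeasure_uniformMeasure_scaledDigits (p := p) hD k.succ_pos
  exact inferInstanceAs (IsProbabilityMeasure (Measure.infinitePi _))

theorem map_eval_digitLaw (k : ℕ) :
    (digitLaw p D).map (fun ω => ω k) = uniformMeasure (scaledDigits p D (k + 1)) := by
  have (k : ℕ) := isProbabilityMeasure_uniformMeasure_scaledDigits (p := p) hD k.succ_pos
  exact (measurePreserving_eval_infinitePi _ k).map_eq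

theorem map_sum_digitLaw (n : ℕ) :
    (digitLaw p D).map (fun ω => ∑ k ∈ Finset.range n, ω k) = partialMoran p D n := by
  have (k : ℕ) := isProbabilityMeasure_uniformMeasure_scaledDigits (p := p) hD k.succ_pos
  have hprob := isProbabilityMeasure_digitLaw (p := p) hD
  induction n with
  | zero =>
    simp only [Finset.range_zero, Finset.sum_empty, partialMoran, Measure.map_const, measure_univ,
      one_smul]
  | succ n ih =>
    have hindep : ProbabilityTheory.iIndepFun (fun k (ω : ℕ → ℝ) => ω k) (digitLaw p D) :=
      ProbabilityTheory.iIndepFun_infinitePi (X := fun _ (x : ℝ) => x) fun _ => measurable_id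
    have hconv := (hindep.indepFun_finsetSum_of_notMem measurable_pi_apply
      (Finset.notMem_range_self (n := n))).map_add_eq_map_conv_map
        (by fun_prop) (measurable_pi_apply n)
    rw [map_eval_digitLaw hD, Finset.sum_fn, ih] at hconv
    rw [partialMoran, ← hconv]
    simp only [Finset.sum_range_succ]
    rfl

theorem ae_digitLaw_abs_le {c : ℕ → ℝ} (hb : ∀ n, ∀ x ∈ scaledDigits p D (n + 1), |x| ≤ c n) :
    ∀ᵐ ω ∂digitLaw p D, ∀ k, |ω k| ≤ c k := by
  refine ae_all_iff.2 fun k => ?_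
  refine ae_of_ae_map (f := fun ω : ℕ → ℝ => ω k) (p := fun x => |x| ≤ c k)
    (measurable_pi_apply k).aemeasurable ?_
  rw [map_eval_digitLaw hD]
  exact (ae_mem_uniformMeasure _).mono (hb k)

theorem exists_isMoranMeasure {c : ℕ → ℝ} (hc : Summable c)
    (hb : ∀ n, ∀ x ∈ scaledDigits p D (n + 1), |x| ≤ c n) :
    ∃ μ : ProbabilityMeasure ℝ, IsMoranMeasure p D μ := by
  have hprob := isProbabilityMeasure_digitLaw (p := p) hD
  let S (n : ℕ) (ω : ℕ → ℝ) : ℝ := ∑ k ∈ Finset.range n, ω k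
  let X (ω : ℕ → ℝ) : ℝ := ∑' k, ω k
  have hS (n : ℕ) : Measurable (S n) :=
    Finset.measurable_sum _ fun k _ => measurable_pi_apply k
  have hbound := ae_digitLaw_abs_le hD hb
  have hlim : ∀ᵐ ω ∂digitLaw p D, Tendsto (fun n => S n ω) atTop (𝓝 (X ω)) :=
    hbound.mono fun ω hω => (Summable.of_norm_bounded hc hω).hasSum.tendsto_sum_nat
  have hX : AEMeasurable X (digitLaw p D) :=
    aemeasurable_of_tendsto_metrizable_ae atTop (fun n => (hS n).aemeasurable) hlim
  have hSX (n : ℕ) : ∀ᵐ ω ∂digitLaw p D, |S n ω| ≤ ∑' k, c k := hbound.mono fun ω hω =>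
    (Finset.abs_sum_le_sum_abs _ _).trans <| (Finset.sum_le_sum fun k _ => hω k).trans <|
      hc.sum_le_tsum _ fun k _ => (abs_nonneg _).trans (hω k)
  refine ⟨⟨(digitLaw p D).map X, Measure.isProbabilityMeasure_map hX⟩,
    ⟨Metric.closedBall 0 (∑' k, c k), isCompact_closedBall _ _, ?_, fun n _ => ?_⟩,
    fun f hf hfc => ?_⟩
  · refine mem_ae_iff.1 ((ae_map_iff hX Metric.isClosed_closedBall.measurableSet).2 ?_)
    exact hbound.mono fun ω hω => mem_closedBall_zero_iff.2 (tsum_of_norm_bounded hc.hasSum hω)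
  · rw [← map_sum_digitLaw hD]
    refine mem_ae_iff.1
      ((ae_map_iff (hS n).aemeasurable Metric.isClosed_closedBall.measurableSet).2 ?_)
    exact (hSX n).mono fun ω hω => mem_closedBall_zero_iff.2 hω
  · obtain ⟨C, hC⟩ := hf.bounded_above_of_compact_support hfc
    have hpartial (n : ℕ) : ∫ x, f x ∂partialMoran p D n = ∫ ω, f (S n ω) ∂digitLaw p D := by
      rw [← map_sum_digitLaw hD, integral_map (hS n).aemeasurable hf.aestronglyMeasurable]
    simp only [hpartial]
    rw [ProbabilityMeasure.coe_mk, integral_map hX hf.aestronglyMeasurable]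
    refine tendsto_integral_of_dominated_convergence (fun _ => C)
      (fun n => (hf.measurable.comp (hS n)).aestronglyMeasurable) (integrable_const _)
      (fun n => Eventually.of_forall fun ω => hC _) ?_
    exact hlim.mono fun ω hω => (hf.tendsto _).comp hω

end Existence

end MoranMeasure

/-- The Fourier transform `∫ exp (2 π i t x) dμ(x)` of a measure on the line. -/
def ft (μ : Measure ℝ) (t : ℝ) : ℂ := charFun μ (2 * Real.pi * t)

section FourierTransform

theorem ft_eq_integral (μ : Measure ℝ) (t : ℝ) : ft μ t = ∫ x, (𝐞 (t * x) : ℂ) ∂μ := by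
  simp only [ft, charFun_apply_real, Real.fourierChar_apply, ← Complex.ofReal_mul, mul_assoc]

theorem norm_ft_neg (μ : Measure ℝ) (t : ℝ) : ‖ft μ (-t)‖ = ‖ft μ t‖ := by
  rw [ft, mul_neg, charFun_neg, RCLike.norm_conj, ft]

theorem ft_zero (μ : Measure ℝ) [IsProbabilityMeasure μ] : ft μ 0 = 1 := by
  simp [ft]

theorem integrable_fourierChar (μ : Measure ℝ) [IsFiniteMeasure μ] (t : ℝ) :
    Integrable (fun x => (𝐞 (t * x) : ℂ)) μ :=
  Integrable.of_bound (by fun_prop) 1 (Eventually.of_forall fun x => (Circle.norm_coe _).le)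

theorem ft_eq_integral_cos_add_integral_sin (μ : Measure ℝ) [IsFiniteMeasure μ] (t : ℝ) :
    ft μ t = (∫ x, Real.cos (2 * Real.pi * (t * x)) ∂μ : ℝ) +
      (∫ x, Real.sin (2 * Real.pi * (t * x)) ∂μ : ℝ) * Complex.I := by
  have h := integral_re_add_im (integrable_fourierChar μ t)
  simp only [RCLike.re_eq_complex_re, RCLike.im_eq_complex_im, re_fourierChar, im_fourierChar]
    at h
  rw [ft_eq_integral, ← h]
  rfl

variable {p : ℕ → ℤ} {D : ℕ → Finset ℤ}

theorem ft_uniformMeasure_scaledDigits {n : ℕ} (hp : moranProd p n ≠ 0) (t : ℝ) :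
    ft (uniformMeasure (scaledDigits p D n)) t = levelMask p D n t := by
  have hinj : Function.Injective fun d : ℤ => (d : ℝ) / moranProd p n :=
    fun d d' h => Int.cast_injective ((div_left_inj' (Int.cast_ne_zero.2 hp)).1 h)
  rw [ft_eq_integral, integral_uniformMeasure, scaledDigits_eq_image,
    Finset.card_image_of_injective _ hinj, Finset.sum_image hinj.injOn, levelMask, mask]
  simp only [mul_div_left_comm t]

variable (hp : ∀ n, 1 ≤ n → p n ≠ 0) (hD : ∀ n, 1 ≤ n → (D n).Nonempty)
include hp hD

theorem ft_partialMoran (n : ℕ) (t : ℝ) :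
    ft (partialMoran p D n) t = ∏ k ∈ Finset.Icc 1 n, levelMask p D k t := by
  induction n with
  | zero => simp [partialMoran, ft]
  | succ n ih =>
    have := isProbabilityMeasure_partialMoran (p := p) hD n
    have := isProbabilityMeasure_uniformMeasure_scaledDigits (p := p) hD n.succ_pos
    rw [Finset.prod_Icc_succ_top n.succ_pos, ← ih,
      ← ft_uniformMeasure_scaledDigits (moranProd_ne_zero hp _), partialMoran, ft, charFun_conv]
    rfl

end FourierTransform

theorem one_sub_sum_norm_sub_one_le_prod_norm {ι : Type*} (s : Finset ι) {z : ι → ℂ}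
    (hz : ∀ i ∈ s, ‖z i‖ ≤ 1) : 1 - ∑ i ∈ s, ‖z i - 1‖ ≤ ∏ i ∈ s, ‖z i‖ := by
  induction s using Finset.cons_induction with
  | empty => simp
  | cons a s ha ih =>
    rw [Finset.forall_mem_cons] at hz
    rw [Finset.sum_cons, Finset.prod_cons]
    have hfactor : 1 - ‖z a - 1‖ ≤ ‖z a‖ := by
      have := norm_sub_norm_le 1 (z a)
      rw [norm_one, norm_sub_rev] at this
      linarith
    have hprod : ∏ i ∈ s, ‖z i‖ ≤ 1 := Finset.prod_le_one (fun i _ => norm_nonneg _) hz.2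
    nlinarith [ih hz.2, norm_nonneg (z a)]

namespace IsMoranMeasure

variable {p : ℕ → ℤ} {D : ℕ → Finset ℤ} {μ : ProbabilityMeasure ℝ}

theorem tendsto_integral (hμ : IsMoranMeasure p D μ) {f : ℝ → ℝ} (hf : Continuous f) :
    Tendsto (fun n => ∫ x, f x ∂partialMoran p D n) atTop (𝓝 (∫ x, f x ∂(μ : Measure ℝ))) := by
  obtain ⟨⟨T, hT, hμT, hT'⟩, hlim⟩ := hμ
  obtain ⟨χ, hχT, -, hχ, -⟩ := exists_continuous_one_zero_of_isCompact hT isClosed_empty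
    (Set.disjoint_empty T)
  have hcut {ν : Measure ℝ} (hν : ν Tᶜ = 0) : ∫ x, χ x * f x ∂ν = ∫ x, f x ∂ν := by
    refine integral_congr_ae ?_
    filter_upwards [mem_ae_iff.2 hν] with x hx
    rw [hχT hx, Pi.one_apply, one_mul]
  rw [← hcut hμT]
  refine (hlim (fun x => χ x * f x) (by fun_prop) hχ.mul_right).congr' ?_
  filter_upwards [eventually_ge_atTop 1] with n hn using hcut (hT' n hn)

variable (hμ : IsMoranMeasure p D μ) (hp : ∀ n, 1 ≤ n → p n ≠ 0)
  (hD : ∀ n, 1 ≤ n → (D n).Nonempty)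
include hμ hp hD

theorem tendsto_prod_levelMask (t : ℝ) :
    Tendsto (fun n => ∏ k ∈ Finset.Icc 1 n, levelMask p D k t) atTop (𝓝 (ft μ t)) := by
  have (n : ℕ) := isProbabilityMeasure_partialMoran (p := p) hD n
  simp only [← ft_partialMoran hp hD, ft_eq_integral_cos_add_integral_sin]
  have hcos := hμ.tendsto_integral (f := fun x => Real.cos (2 * Real.pi * (t * x))) (by fun_prop)
  have hsin := hμ.tendsto_integral (f := fun x => Real.sin (2 * Real.pi * (t * x))) (by fun_prop)
  exact ((Complex.continuous_ofReal.tendsto _).comp hcos).add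
    (((Complex.continuous_ofReal.tendsto _).comp hsin).mul_const Complex.I)

theorem norm_ft_le_prod (t : ℝ) (n : ℕ) :
    ‖ft μ t‖ ≤ ∏ k ∈ Finset.Icc 1 n, ‖levelMask p D k t‖ := by
  refine le_of_tendsto (hμ.tendsto_prod_levelMask hp hD t).norm ?_
  filter_upwards [eventually_ge_atTop n] with m hm
  rw [norm_prod]
  exact Finset.prod_le_prod_of_subset_of_le_one (Finset.Icc_subset_Icc_right hm)
    (fun k _ => norm_nonneg _) fun k _ _ => norm_levelMask_le_one p D k t

theorem ft_eq_zero {t : ℝ} {k : ℕ} (hk : 1 ≤ k) (hz : levelMask p D k t = 0) : ft μ t = 0 := by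
  have h := hμ.norm_ft_le_prod hp hD t k
  rw [Finset.prod_eq_zero (Finset.mem_Icc.2 ⟨hk, le_rfl⟩) (by rw [hz, norm_zero])] at h
  exact norm_le_zero_iff.1 h

theorem half_prod_le_norm_ft {t : ℝ} {N : ℕ}
    (h : ∀ n, ∑ k ∈ Finset.Ioc N n, ‖levelMask p D k t - 1‖ ≤ 1 / 2) :
    (∏ k ∈ Finset.Icc 1 N, ‖levelMask p D k t‖) / 2 ≤ ‖ft μ t‖ := by
  refine ge_of_tendsto (hμ.tendsto_prod_levelMask hp hD t).norm ?_
  filter_upwards [eventually_ge_atTop N] with n hn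
  have htail : 1 / 2 ≤ ∏ k ∈ Finset.Ioc N n, ‖levelMask p D k t‖ := by
    have := one_sub_sum_norm_sub_one_le_prod_norm (Finset.Ioc N n)
      fun k _ => norm_levelMask_le_one p D k t
    linarith [h n]
  rw [norm_prod]
  change _ ≤ ∏ k ∈ Finset.Ioc 0 n, _
  rw [← Finset.prod_Ioc_consecutive _ N.zero_le hn, div_eq_mul_one_div]
  exact mul_le_mul_of_nonneg_left htail (Finset.prod_nonneg fun k _ => norm_nonneg _)

theorem exists_levelMask_eq_zero {t : ℝ} (hs : Summable fun k => ‖levelMask p D k t - 1‖)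
    (ht : ft μ t = 0) : ∃ k, 1 ≤ k ∧ levelMask p D k t = 0 := by
  by_contra! hne
  obtain ⟨s, hs⟩ := summable_iff_vanishing_norm.1 hs (1 / 2) one_half_pos
  have hhalf := hμ.half_prod_le_norm_ft hp hD (t := t) (N := s.sup id) fun n => by
    have hdisj : Disjoint (Finset.Ioc (s.sup id) n) s := Finset.disjoint_left.2 fun k hk hks =>
      (Finset.mem_Ioc.1 hk).1.not_ge (Finset.le_sup (f := id) hks)
    exact (le_abs_self _).trans (hs _ hdisj).le
  have hpos : 0 < ∏ k ∈ Finset.Icc 1 (s.sup id), ‖levelMask p D k t‖ :=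
    Finset.prod_pos fun k hk => norm_pos_iff.2 (hne k (Finset.mem_Icc.1 hk).1)
  rw [ht, norm_zero] at hhalf
  linarith

end IsMoranMeasure

theorem ofReal_sqrt_natCast_mul_self (n : ℕ) : ((√(n : ℝ) : ℝ) : ℂ) * (√(n : ℝ) : ℝ) = n := by
  rw [← Complex.ofReal_mul, Real.mul_self_sqrt (Nat.cast_nonneg _), Complex.ofReal_natCast]

section FiniteCode

variable {ι τ : Type*} [Fintype ι] [DecidableEq ι] {D : ι → Finset ℤ}

/-- The exponential with frequency `x i` in the `i`-th of finitely many independent uniform digits,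
normalized to a unit vector of the Hilbert space of functions on the code space `∏ D i`. -/
def codeVec (D : ι → Finset ℤ) (x : ι → ℝ) : EuclideanSpace ℂ (∀ i, D i) :=
  WithLp.toLp 2 fun ω => ∏ i, (𝐞 (ω i * x i) : ℂ) / √((D i).card : ℝ)

theorem inner_codeVec (D : ι → Finset ℤ) (x y : ι → ℝ) :
    inner ℂ (codeVec D x) (codeVec D y) = ∏ i, mask (D i) (y i - x i) := by
  have hfactor (i : ι) : mask (D i) (y i - x i) =
      ∑ d : D i, (𝐞 (d * y i) : ℂ) / √((D i).card : ℝ) *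
        starRingEnd ℂ ((𝐞 (d * x i) : ℂ) / √((D i).card : ℝ)) := by
    rw [mask, Finset.sum_div, ← Finset.sum_coe_sort]
    refine Finset.sum_congr rfl fun d _ => ?_
    rw [mul_sub, coe_fourierChar_sub, map_div₀, Complex.conj_ofReal, div_mul_div_comm,
      ofReal_sqrt_natCast_mul_self]
  rw [PiLp.inner_apply, Finset.prod_congr rfl fun i _ => hfactor i, Finset.prod_univ_sum,
    Fintype.piFinset_univ]
  simp only [codeVec, RCLike.inner_apply, map_prod, Finset.prod_mul_distrib]

theorem norm_codeVec (hD : ∀ i, (D i).Nonempty) (x : ι → ℝ) : ‖codeVec D x‖ = 1 := by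
  refine (sq_eq_sq₀ (norm_nonneg _) zero_le_one).1 ?_
  rw [← inner_self_eq_norm_sq (𝕜 := ℂ), inner_codeVec]
  simp only [sub_self, mask_zero (hD _), Finset.prod_const_one, RCLike.one_re, one_pow]

variable {T : Finset τ} {x : τ → ι → ℝ} (hD : ∀ i, (D i).Nonempty)
  (hx : ∀ s ∈ T, ∀ t ∈ T, s ≠ t → ∃ i, mask (D i) (x t i - x s i) = 0)
include hD hx

theorem orthonormal_codeVec : Orthonormal ℂ fun t : T => codeVec D (x t) := by
  refine ⟨fun t => norm_codeVec hD _, fun s t hst => ?_⟩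
  obtain ⟨i, hi⟩ := hx s s.2 t t.2 (Subtype.coe_ne_coe.2 hst)
  rw [inner_codeVec]
  exact Finset.prod_eq_zero (Finset.mem_univ i) hi

omit [DecidableEq ι] in
theorem sum_prod_norm_mask_sq_le_one : ∑ t ∈ T, ∏ i, ‖mask (D i) (x t i)‖ ^ 2 ≤ 1 := by
  classical
  have hbessel := (orthonormal_codeVec hD hx).sum_inner_products_le (s := Finset.univ)
    (codeVec D 0)
  rw [norm_codeVec hD, one_pow] at hbessel
  refine hbessel.trans_eq' ?_
  rw [← Finset.sum_coe_sort T]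
  refine Finset.sum_congr rfl fun t _ => ?_
  simp only [inner_codeVec, Pi.zero_apply, zero_sub, mask_neg, norm_prod, RCLike.norm_conj,
    Finset.prod_pow]

omit [DecidableEq ι] in
theorem card_le_prod_card : T.card ≤ ∏ i, (D i).card := by
  classical
  have h := (orthonormal_codeVec hD hx).linearIndependent.fintype_card_le_finrank
  simpa using h

end FiniteCode

section LevelMask

variable {p : ℕ → ℤ} {D : ℕ → Finset ℤ} {T : Finset ℝ} (hD : ∀ n, 1 ≤ n → (D n).Nonempty)
include hD

/- A frequency `t` truncated at level `K t` does not involve the digits of the later levels, where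
its mask is `mask D 0 = 1`. -/
theorem sum_prod_levelMask_le_one {K : ℝ → ℕ} (hT : ∀ s ∈ T, ∀ t ∈ T, s ≠ t →
      ∃ k, 1 ≤ k ∧ k ≤ K s ∧ k ≤ K t ∧ levelMask p D k (t - s) = 0) :
    ∑ t ∈ T, ∏ k ∈ Finset.Icc 1 (K t), ‖levelMask p D k t‖ ^ 2 ≤ 1 := by
  set N := T.sup K
  have hDN (i : Finset.Icc 1 N) : (D i).Nonempty := hD i (Finset.mem_Icc.1 i.2).1
  let x (t : ℝ) (i : Finset.Icc 1 N) : ℝ := if (i : ℕ) ≤ K t then t / moranProd p i else 0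
  have hx : ∀ s ∈ T, ∀ t ∈ T, s ≠ t → ∃ i : Finset.Icc 1 N, mask (D i) (x t i - x s i) = 0 := by
    intro s hs t ht hst
    obtain ⟨k, hk, hks, hkt, hz⟩ := hT s hs t ht hst
    refine ⟨⟨k, Finset.mem_Icc.2 ⟨hk, hks.trans (Finset.le_sup hs)⟩⟩, ?_⟩
    simpa only [x, if_pos hks, if_pos hkt, ← sub_div, levelMask] using hz
  refine (sum_prod_norm_mask_sq_le_one hDN hx).trans_eq' (Finset.sum_congr rfl fun t ht => ?_)
  have hsub : Finset.Icc 1 (K t) ⊆ Finset.Icc 1 N :=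
    Finset.Icc_subset_Icc_right (Finset.le_sup ht)
  rw [Finset.prod_coe_sort (Finset.Icc 1 N)
    fun k => ‖mask (D k) (if k ≤ K t then t / moranProd p k else 0)‖ ^ 2,
    ← Finset.prod_subset hsub]
  · refine Finset.prod_congr rfl fun k hk => ?_
    rw [if_pos (Finset.mem_Icc.1 hk).2, levelMask]
  · intro k hk hkK
    have hk1 := (Finset.mem_Icc.1 hk).1
    rw [if_neg fun h => hkK (Finset.mem_Icc.2 ⟨hk1, h⟩), mask_zero (hD k hk1), norm_one, one_pow]

theorem card_le_prod_card_of_levelMask {N : ℕ} (hT : ∀ s ∈ T, ∀ t ∈ T, s ≠ t →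
      ∃ k, 1 ≤ k ∧ k ≤ N ∧ levelMask p D k (t - s) = 0) :
    T.card ≤ ∏ k ∈ Finset.Icc 1 N, (D k).card := by
  rw [← Finset.prod_coe_sort]
  refine card_le_prod_card (x := fun t i => t / moranProd p i)
    (fun i => hD i (Finset.mem_Icc.1 i.2).1) fun s hs t ht hst => ?_
  obtain ⟨k, hk, hkN, hz⟩ := hT s hs t ht hst
  exact ⟨⟨k, Finset.mem_Icc.2 ⟨hk, hkN⟩⟩, by rwa [← sub_div]⟩

end LevelMask

section ParsevalDefect

variable {E ι : Type*} [NormedAddCommGroup E] [InnerProductSpace ℂ E]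

/- Equality in Bessel's inequality: the projection to the closed span preserves the norm. -/
theorem mem_closure_span_of_hasSum [CompleteSpace E] {v : ι → E} (hv : Orthonormal ℂ v) {x : E}
    (hx : HasSum (fun i => ‖inner ℂ (v i) x‖ ^ 2) (‖x‖ ^ 2)) :
    x ∈ (Submodule.span ℂ (Set.range v)).topologicalClosure := by
  set U := (Submodule.span ℂ (Set.range v)).topologicalClosure
  have hproj (i : ι) : inner ℂ (v i) (U.starProjection x) = inner ℂ (v i) x := by
    have hvi : v i ∈ U :=
      Submodule.le_topologicalClosure _ (Submodule.subset_span (Set.mem_range_self i))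
    rw [← U.inner_starProjection_left_eq_right, Submodule.starProjection_eq_self_iff.2 hvi]
  refine (U.mem_iff_norm_starProjection x).2 ((U.norm_starProjection_apply_le x).antisymm ?_)
  have hbessel := hv.tsum_inner_products_le (U.starProjection x)
  simp only [hproj, hx.tsum_eq] at hbessel
  exact le_of_sq_le_sq hbessel (norm_nonneg _)

end ParsevalDefect

section Completeness

variable {ν : Measure ℝ}

theorem integrable_fourierChar_mul {f : ℝ → ℂ} (hf : Integrable f ν) (t : ℝ) :
    Integrable (fun x => (𝐞 (t * x) : ℂ) * f x) ν :=
  hf.bdd_mul (c := 1) (by fun_prop) (Eventually.of_forall fun x => (Circle.norm_coe _).le)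

theorem charFun_withDensity_ofReal {g : ℝ → ℝ} (hg : Integrable g ν) (t : ℝ) :
    charFun (ν.withDensity fun x => ENNReal.ofReal (g x)) (2 * Real.pi * t) =
      ∫ x, (𝐞 (t * x) : ℂ) * (max (g x) 0 : ℝ) ∂ν := by
  rw [← ft, ft_eq_integral,
    integral_withDensity_eq_integral_toReal_smul₀ hg.aemeasurable.ennreal_ofReal (by simp)]
  simp only [ENNReal.toReal_ofReal', Complex.real_smul, mul_comm]

/- The positive and the negative part of `g` are densities with the same characteristic function. -/
theorem ae_eq_zero_of_integral_fourierChar_mul_ofReal {g : ℝ → ℝ} (hg : Integrable g ν)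
    (h : ∀ t, ∫ x, (𝐞 (t * x) : ℂ) * g x ∂ν = 0) : g =ᵐ[ν] 0 := by
  have hfin := isFiniteMeasure_withDensity hg.lintegral_lt_top.ne
  have hfin' := isFiniteMeasure_withDensity hg.neg.lintegral_lt_top.ne
  have hint (f : ℝ → ℝ) (hf : Integrable f ν) (t : ℝ) :
      Integrable (fun x => (𝐞 (t * x) : ℂ) * (max (f x) 0 : ℝ)) ν :=
    integrable_fourierChar_mul hf.pos_part.ofReal t
  have hparts : ν.withDensity (fun x => ENNReal.ofReal (g x)) =
      ν.withDensity (fun x => ENNReal.ofReal ((-g) x)) := by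
    refine Measure.ext_of_charFun (funext fun u => ?_)
    obtain ⟨t, rfl⟩ : ∃ t, u = 2 * Real.pi * t :=
      ⟨u / (2 * Real.pi), (mul_div_cancel₀ u Real.two_pi_pos.ne').symm⟩
    rw [charFun_withDensity_ofReal hg, charFun_withDensity_ofReal hg.neg, ← sub_eq_zero,
      ← integral_sub (hint _ hg t) (hint _ hg.neg t), ← h t]
    simp only [← mul_sub, ← Complex.ofReal_sub, Pi.neg_apply, max_zero_sub_eq_self]
  rw [withDensity_eq_iff hg.aemeasurable.ennreal_ofReal hg.neg.aemeasurable.ennreal_ofReal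
    hg.lintegral_lt_top.ne] at hparts
  filter_upwards [hparts] with x hx
  have hx' := congrArg ENNReal.toReal hx
  simp only [ENNReal.toReal_ofReal', Pi.neg_apply] at hx'
  rw [← max_zero_sub_eq_self (g x), hx', sub_self, Pi.zero_apply]

theorem ae_re_eq_zero_of_integral_fourierChar_mul {f : ℝ → ℂ} (hf : Integrable f ν)
    (h : ∀ t, ∫ x, (𝐞 (t * x) : ℂ) * f x ∂ν = 0) : (fun x => (f x).re) =ᵐ[ν] 0 := by
  have hfc : Integrable (fun x => starRingEnd ℂ (f x)) ν :=
    (RCLike.conjLIE (K := ℂ)).integrable_comp_iff.2 hf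
  have hconj (t : ℝ) : ∫ x, (𝐞 (t * x) : ℂ) * starRingEnd ℂ (f x) ∂ν = 0 := by
    rw [← map_zero (starRingEnd ℂ), ← h (-t), ← integral_conj]
    simp only [neg_mul, map_mul, coe_fourierChar_neg, Complex.conj_conj]
  refine ae_eq_zero_of_integral_fourierChar_mul_ofReal hf.re fun t => ?_
  simp only [Complex.re_eq_add_conj, mul_div_assoc', mul_add]
  rw [integral_div, integral_add (integrable_fourierChar_mul hf t)
    (integrable_fourierChar_mul hfc t), h, hconj, add_zero, zero_div]

theorem ae_eq_zero_of_integral_fourierChar_mul {f : ℝ → ℂ} (hf : Integrable f ν)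
    (h : ∀ t, ∫ x, (𝐞 (t * x) : ℂ) * f x ∂ν = 0) : f =ᵐ[ν] 0 := by
  have him := ae_re_eq_zero_of_integral_fourierChar_mul (hf.const_mul (-Complex.I)) fun t => by
    simp only [mul_left_comm _ (-Complex.I)]
    rw [integral_const_mul, h, mul_zero]
  filter_upwards [ae_re_eq_zero_of_integral_fourierChar_mul hf h, him] with x hre him
  refine Complex.ext hre ?_
  simpa using him

end Completeness

section ExpL2

variable (μ : ProbabilityMeasure ℝ)

theorem expL2_coeFn (t : ℝ) : expL2 μ t =ᵐ[(μ : Measure ℝ)] fun x => (𝐞 (t * x) : ℂ) := by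
  filter_upwards [(memLp_exp μ t).coeFn_toLp] with x hx
  rw [expL2, hx, Real.fourierChar_apply]
  push_cast
  ring_nf

theorem inner_expL2 (s t : ℝ) :
    inner ℂ (expL2 μ s) (expL2 μ t) = ft (μ : Measure ℝ) (t - s) := by
  rw [L2.inner_def, ft_eq_integral]
  refine integral_congr_ae ?_
  filter_upwards [expL2_coeFn μ s, expL2_coeFn μ t] with x hs ht
  rw [hs, ht, RCLike.inner_apply, sub_mul, coe_fourierChar_sub]

theorem norm_expL2 (t : ℝ) : ‖expL2 μ t‖ = 1 := by
  refine (sq_eq_sq₀ (norm_nonneg _) zero_le_one).1 ?_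
  rw [← inner_self_eq_norm_sq (𝕜 := ℂ), inner_expL2, sub_self, ft_zero, RCLike.one_re, one_pow]

theorem norm_inner_expL2_neg (ξ t : ℝ) :
    ‖inner ℂ (expL2 μ t) (expL2 μ (-ξ))‖ = ‖ft (μ : Measure ℝ) (ξ + t)‖ := by
  rw [inner_expL2, ← norm_ft_neg]
  ring_nf

variable {μ}

theorem eq_zero_of_inner_expL2 {f : Lp ℂ 2 (μ : Measure ℝ)}
    (hf : ∀ t, inner ℂ (expL2 μ t) f = 0) : f = 0 := by
  refine (Lp.eq_zero_iff_ae_eq_zero).2 (ae_eq_zero_of_integral_fourierChar_mul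
    ((Lp.memLp f).integrable one_le_two) fun t => ?_)
  rw [← hf (-t), L2.inner_def]
  refine integral_congr_ae ?_
  filter_upwards [expL2_coeFn μ (-t)] with x hx
  rw [hx, RCLike.inner_apply, neg_mul, coe_fourierChar_neg, Complex.conj_conj, mul_comm]

theorem orthonormal_expL2 {ι : Type*} {l : ι → ℝ}
    (hl : ∀ i j, i ≠ j → ft (μ : Measure ℝ) (l i - l j) = 0) :
    Orthonormal ℂ fun i => expL2 μ (l i) :=
  ⟨fun _ => norm_expL2 μ _, fun i j hij => (inner_expL2 μ _ _).trans (hl j i hij.symm)⟩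

theorem IsSpectrum.ft_sub_eq_zero {Λ : Set ℝ} (h : IsSpectrum μ Λ) {s t : ℝ} (hs : s ∈ Λ)
    (ht : t ∈ Λ) (hst : s ≠ t) : ft (μ : Measure ℝ) (t - s) = 0 := by
  rw [← inner_expL2]
  exact h.2.1 s hs t ht hst

theorem IsSpectrum.hasSum {Λ : Set ℝ} (h : IsSpectrum μ Λ) (ξ : ℝ) :
    HasSum (fun t : Λ => ‖ft (μ : Measure ℝ) (ξ + t)‖ ^ 2) 1 := by
  have horth : Orthonormal ℂ fun t : Λ => expL2 μ t :=
    orthonormal_expL2 fun s t hst => h.ft_sub_eq_zero t.2 s.2 fun e => hst (Subtype.ext e.symm)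
  have hspan : ⊤ ≤ (Submodule.span ℂ (Set.range fun t : Λ => expL2 μ t)).topologicalClosure := by
    rw [← h.2.2, Set.image_eq_range]
  have hparseval := RCLike.hasSum_re ℂ
    ((HilbertBasis.mk horth hspan).hasSum_inner_mul_inner (expL2 μ (-ξ)) (expL2 μ (-ξ)))
  rw [inner_self_eq_norm_sq, norm_expL2, one_pow] at hparseval
  refine hparseval.congr_fun fun t => ?_
  rw [inner_mul_symm_re_eq_norm, norm_mul, norm_inner_symm, ← sq, HilbertBasis.coe_mk,
    norm_inner_expL2_neg]

theorem isSpectrum_range {ι : Type*} [Countable ι] {l : ι → ℝ}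
    (ho : ∀ i j, i ≠ j → ft (μ : Measure ℝ) (l i - l j) = 0)
    (hs : ∀ ξ, HasSum (fun i => ‖ft (μ : Measure ℝ) (ξ + l i)‖ ^ 2) 1) :
    IsSpectrum μ (Set.range l) := by
  refine ⟨Set.countable_range l, ?_, ?_⟩
  · rintro _ ⟨i, rfl⟩ _ ⟨j, rfl⟩ hij
    rw [inner_expL2]
    exact ho j i (ne_of_apply_ne l hij.symm)
  rw [← Set.range_comp, Submodule.topologicalClosure_eq_top_iff, Submodule.eq_bot_iff]
  intro f hf
  rw [← Submodule.orthogonal_closure] at hf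
  refine eq_zero_of_inner_expL2 fun t => hf _ ?_
  refine mem_closure_span_of_hasSum (orthonormal_expL2 ho) ?_
  rw [norm_expL2, one_pow]
  refine (hs (-t)).congr_fun fun i => ?_
  rw [← norm_inner_expL2_neg, neg_neg]

end ExpL2

section HadamardTriple

/-- The matrix `H` of the definition of a Hadamard triple, with its entries written through the
standard additive character. -/
def hadamardMatrix (R : ℤ) (D L : Finset ℤ) : Matrix L D ℂ :=
  Matrix.of fun l d => (𝐞 (d * (l / R)) : ℂ) / √(D.card : ℝ)

variable {R : ℤ} {D L : Finset ℤ}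

theorem isHadamardTriple_iff : IsHadamardTriple R D L ↔ 1 < |R| ∧ D.card = L.card ∧
    (hadamardMatrix R D L).conjTranspose * hadamardMatrix R D L = 1 := by
  have h : (Matrix.of fun (l : L) (d : D) => ((1 / Real.sqrt (D.card : ℝ) : ℝ) : ℂ) *
      Complex.exp (2 * Real.pi * Complex.I * (((d : ℤ) : ℂ) * ((l : ℤ) : ℂ) / (R : ℂ)))) =
      hadamardMatrix R D L := by
    ext l d
    simp only [hadamardMatrix, Matrix.of_apply, Real.fourierChar_apply]
    push_cast
    ring_nf
  rw [← h]
  rfl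

theorem hadamardMatrix_conjTranspose_mul_self (d d' : D) :
    ((hadamardMatrix R D L).conjTranspose * hadamardMatrix R D L) d d' =
      (∑ l ∈ L, (𝐞 ((d' - d : ℤ) * (l / R)) : ℂ)) / D.card := by
  rw [Matrix.mul_apply, Finset.sum_div, ← Finset.sum_coe_sort L]
  refine Finset.sum_congr rfl fun l _ => ?_
  rw [Matrix.conjTranspose_apply, hadamardMatrix, Matrix.of_apply, Matrix.of_apply,
    ← starRingEnd_apply, map_div₀, Complex.conj_ofReal, div_mul_div_comm,
    ofReal_sqrt_natCast_mul_self, Int.cast_sub, sub_mul, coe_fourierChar_sub,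
    mul_comm (starRingEnd ℂ _)]

theorem hadamardMatrix_mul_conjTranspose_self (l l' : L) :
    (hadamardMatrix R D L * (hadamardMatrix R D L).conjTranspose) l l' =
      mask D ((l - l') / R) := by
  rw [Matrix.mul_apply, mask, Finset.sum_div, ← Finset.sum_coe_sort D]
  refine Finset.sum_congr rfl fun d _ => ?_
  rw [Matrix.conjTranspose_apply, hadamardMatrix, Matrix.of_apply, Matrix.of_apply,
    ← starRingEnd_apply, map_div₀, Complex.conj_ofReal, div_mul_div_comm,
    ofReal_sqrt_natCast_mul_self, sub_div, mul_sub, coe_fourierChar_sub]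

theorem isHadamardTriple_of_not_dvd {N : ℕ} {r : ℤ} (hR : 1 < |N * r|) (hcard : D.card = N)
    (hD : ∀ d ∈ D, ∀ d' ∈ D, d ≠ d' → ¬ (N : ℤ) ∣ d' - d) :
    IsHadamardTriple (N * r) D ((Finset.range N).image fun c : ℕ => r * c) := by
  obtain ⟨hN, hr⟩ : N ≠ 0 ∧ r ≠ 0 := by
    constructor <;> rintro rfl <;> simp at hR
  have hinj : Function.Injective fun c : ℕ => r * c :=
    fun c c' h => Nat.cast_injective (mul_left_cancel₀ hr h)
  refine isHadamardTriple_iff.2 ⟨hR, ?_, ?_⟩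
  · rw [Finset.card_image_of_injective _ hinj, Finset.card_range, hcard]
  ext d d'
  have hsum : ∑ l ∈ (Finset.range N).image (fun c : ℕ => r * c),
      (𝐞 ((d' - d : ℤ) * (l / (N * r : ℤ))) : ℂ) =
        ∑ c ∈ Finset.range N, (𝐞 (c * ((d' - d : ℤ) / N)) : ℂ) := by
    have hr' : (r : ℝ) ≠ 0 := Int.cast_ne_zero.2 hr
    rw [Finset.sum_image hinj.injOn]
    refine Finset.sum_congr rfl fun c _ => congrArg (fun x => (𝐞 x : ℂ)) ?_
    push_cast
    field_simp
  rw [hadamardMatrix_conjTranspose_mul_self, hsum]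
  rcases eq_or_ne d d' with rfl | hne
  · simp [hcard, hN]
  · rw [sum_range_fourierChar_eq_zero hN (hD d d.2 d' d'.2 (Subtype.coe_ne_coe.2 hne)), zero_div,
      Matrix.one_apply_ne hne]

variable (h : IsHadamardTriple R D L)
include h

theorem IsHadamardTriple.ne_zero : R ≠ 0 := by
  rintro rfl
  simpa using h.1

theorem IsHadamardTriple.mask_eq_zero {l l' : ℤ} (hl : l ∈ L) (hl' : l' ∈ L) (hne : l ≠ l') :
    mask D ((l - l') / R) = 0 := by
  obtain ⟨-, hcard, hH⟩ := isHadamardTriple_iff.1 h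
  have hH' : hadamardMatrix R D L * (hadamardMatrix R D L).conjTranspose = 1 :=
    (Matrix.mul_eq_one_comm_of_card_eq _ _ _ (by simpa using hcard.symm)).2 hH
  have hentry := hadamardMatrix_mul_conjTranspose_self (R := R) (D := D) ⟨l, hl⟩ ⟨l', hl'⟩
  rwa [hH', Matrix.one_apply_ne (by simpa using hne), eq_comm] at hentry

/- The values `mask D (x + l / R)` are the coordinates of the image under `H` of the unit vector
with coordinates `𝐞 (d * x) / √#D`. -/
theorem IsHadamardTriple.sum_norm_mask_sq (hD : D.Nonempty) (x : ℝ) :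
    ∑ l ∈ L, ‖mask D (x + l / R)‖ ^ 2 = 1 := by
  have hH := (isHadamardTriple_iff.1 h).2.2
  set v : D → ℂ := fun d => (𝐞 (d * x) : ℂ) / √(D.card : ℝ) with hv
  have hmask (l : L) : mask D (x + l / R) = (hadamardMatrix R D L).mulVec v l := by
    rw [Matrix.mulVec, dotProduct, mask, Finset.sum_div, ← Finset.sum_coe_sort D]
    refine Finset.sum_congr rfl fun d _ => ?_
    rw [hadamardMatrix, Matrix.of_apply, hv, div_mul_div_comm, ofReal_sqrt_natCast_mul_self,
      mul_add, coe_fourierChar_add, mul_comm (𝐞 (d * x) : ℂ)]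
  have hunit : star v ⬝ᵥ v = 1 := by
    have hterm (d : D) : star v d * v d = 1 / D.card := by
      rw [hv, Pi.star_apply, ← starRingEnd_apply, map_div₀,
        Complex.conj_ofReal, div_mul_div_comm, ofReal_sqrt_natCast_mul_self, Complex.conj_mul',
        Circle.norm_coe]
      simp
    rw [dotProduct, Finset.sum_congr rfl fun d _ => hterm d]
    simp [hD.card_ne_zero]
  have hiso : star ((hadamardMatrix R D L).mulVec v) ⬝ᵥ (hadamardMatrix R D L).mulVec v = 1 := by
    rw [Matrix.star_mulVec, Matrix.dotProduct_mulVec, Matrix.vecMul_vecMul, hH, Matrix.vecMul_one,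
      hunit]
  rw [← Complex.ofReal_inj, ← Finset.sum_coe_sort, Complex.ofReal_sum, Complex.ofReal_one, ← hiso]
  refine Finset.sum_congr rfl fun l _ => ?_
  rw [hmask, Pi.star_apply, ← starRingEnd_apply, Complex.conj_mul', Complex.ofReal_pow]

end HadamardTriple

section Spectrality

variable {p : ℕ → ℤ} {D L : ℕ → Finset ℤ}

theorem levelMask_zero {k : ℕ} (hD : (D k).Nonempty) : levelMask p D k 0 = 1 := by
  rw [levelMask, zero_div, mask_zero hD]

theorem levelMask_add_mul_of_le {k n : ℕ} (hP : moranProd p k ≠ 0) (hkn : k ≤ n) (t : ℝ) (z : ℤ) :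
    levelMask p D k (t + moranProd p n * z) = levelMask p D k t := by
  obtain ⟨w, hw⟩ : moranProd p k ∣ moranProd p n :=
    Finset.prod_dvd_prod_of_subset _ _ _ (Finset.Icc_subset_Icc_right hkn)
  have hP' : (moranProd p k : ℝ) ≠ 0 := Int.cast_ne_zero.2 hP
  rw [levelMask, hw, Int.cast_mul, add_div, mul_assoc, mul_div_cancel_left₀ _ hP', ← Int.cast_mul,
    mask_add_intCast, levelMask]

theorem levelMask_succ_add_mul {n : ℕ} (hP : moranProd p n ≠ 0) (t : ℝ) (z : ℤ) :
    levelMask p D (n + 1) (t + moranProd p n * z) =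
      mask (D (n + 1)) (t / moranProd p (n + 1) + z / p (n + 1)) := by
  have hP' : (moranProd p n : ℝ) ≠ 0 := Int.cast_ne_zero.2 hP
  rw [levelMask, add_div, moranProd_succ, Int.cast_mul, mul_div_mul_left _ _ hP']

/-- The frequencies `l_1 + p_1 l_2 + ⋯ + p_1 ⋯ p_{n-1} l_n` with `l_k ∈ L_k`; if the `L_k` complete
Hadamard triples they form a spectrum of the `n`-th partial convolution. -/
def spectrumLevel (p : ℕ → ℤ) (L : ℕ → Finset ℤ) : ℕ → Finset ℤ
  | 0 => {0}
  | n + 1 => (spectrumLevel p L n ×ˢ L (n + 1)).image fun q => q.1 + moranProd p n * q.2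

/-- The union of the sets `spectrumLevel p L n`, the candidate spectrum of the Moran measure. -/
def spectrumUnion (p : ℕ → ℤ) (L : ℕ → Finset ℤ) : Set ℤ := ⋃ n, (spectrumLevel p L n : Set ℤ)

theorem monotone_spectrumLevel (h0 : ∀ n, 1 ≤ n → (0 : ℤ) ∈ L n) :
    Monotone (spectrumLevel p L) := by
  refine monotone_nat_of_le_succ fun n a ha => Finset.mem_image.2 ⟨(a, 0), ?_, by simp⟩
  exact Finset.mk_mem_product ha (h0 _ n.succ_pos)

theorem mem_Ico_of_mem_spectrumLevel (hL : ∀ n, 1 ≤ n → ∀ l ∈ L n, l ∈ Finset.Ico 0 (p n)) {n : ℕ}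
    {a : ℤ} (ha : a ∈ spectrumLevel p L n) : a ∈ Finset.Ico 0 (moranProd p n) := by
  induction n generalizing a with
  | zero =>
    rw [Finset.mem_singleton.1 ha]
    exact Finset.mem_Ico.2 ⟨le_rfl, one_pos⟩
  | succ n ih =>
    simp only [spectrumLevel, Finset.mem_image, Finset.mem_product, Prod.exists] at ha
    obtain ⟨b, l, ⟨hb, hl⟩, rfl⟩ := ha
    obtain ⟨hb0, hb1⟩ := Finset.mem_Ico.1 (ih hb)
    obtain ⟨hl0, hl1⟩ := Finset.mem_Ico.1 (hL _ n.succ_pos l hl)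
    rw [moranProd_succ, Finset.mem_Ico]
    constructor <;> nlinarith

variable (hH : ∀ n, 1 ≤ n → IsHadamardTriple (p n) (D n) (L n))
include hH

theorem exists_levelMask_sub_eq_zero {n : ℕ} {a b : ℤ} (ha : a ∈ spectrumLevel p L n)
    (hb : b ∈ spectrumLevel p L n) (hab : a ≠ b) :
    ∃ k, 1 ≤ k ∧ k ≤ n ∧ levelMask p D k (a - b) = 0 := by
  have hP (n : ℕ) : moranProd p n ≠ 0 := moranProd_ne_zero (fun n hn => (hH n hn).ne_zero) n
  induction n generalizing a b with
  | zero => exact absurd ((Finset.mem_singleton.1 ha).trans (Finset.mem_singleton.1 hb).symm) hab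
  | succ n ih =>
    simp only [spectrumLevel, Finset.mem_image, Finset.mem_product, Prod.exists] at ha hb
    obtain ⟨a', l, ⟨ha', hl⟩, rfl⟩ := ha
    obtain ⟨b', l', ⟨hb', hl'⟩, rfl⟩ := hb
    have hsub : ((a' + moranProd p n * l : ℤ) : ℝ) - (b' + moranProd p n * l' : ℤ) =
        (a' - b' : ℝ) + moranProd p n * (l - l' : ℤ) := by
      push_cast
      ring
    simp only [hsub]
    rcases eq_or_ne a' b' with rfl | hne
    · refine ⟨n + 1, n.succ_pos, le_rfl, ?_⟩
      rw [levelMask_succ_add_mul (hP n), sub_self, zero_div, zero_add, Int.cast_sub]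
      exact (hH _ n.succ_pos).mask_eq_zero hl hl' fun h => hab (by rw [h])
    · obtain ⟨k, hk, hkn, hz⟩ := ih ha' hb' hne
      exact ⟨k, hk, hkn.trans n.le_succ, by rw [levelMask_add_mul_of_le (hP k) hkn, hz]⟩

variable (hD : ∀ n, 1 ≤ n → (D n).Nonempty)
include hD

theorem injOn_add_moranProd_mul (n : ℕ) : Set.InjOn (fun q : ℤ × ℤ => q.1 + moranProd p n * q.2)
    (spectrumLevel p L n ×ˢ L (n + 1) : Finset (ℤ × ℤ)) := by
  have hP (n : ℕ) : moranProd p n ≠ 0 := moranProd_ne_zero (fun n hn => (hH n hn).ne_zero) n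
  rintro ⟨a, l⟩ hal ⟨b, l'⟩ hbl (heq : a + moranProd p n * l = b + moranProd p n * l')
  rw [Finset.mem_coe, Finset.mem_product] at hal hbl
  have hab : a = b := by
    by_contra hne
    obtain ⟨k, hk, hkn, hz⟩ := exists_levelMask_sub_eq_zero hH hal.1 hbl.1 hne
    have hsub : (a - b : ℝ) = 0 + moranProd p n * (l' - l : ℤ) := by
      have heq' : (a + moranProd p n * l : ℝ) = b + moranProd p n * l' := by exact_mod_cast heq
      push_cast
      linarith
    rw [hsub, levelMask_add_mul_of_le (hP k) hkn, levelMask_zero (hD k hk)] at hz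
    exact one_ne_zero hz
  subst hab
  rw [mul_left_cancel₀ (hP n) (add_left_cancel heq)]

theorem sum_spectrumLevel_prod_levelMask (ξ : ℝ) (n : ℕ) :
    ∑ a ∈ spectrumLevel p L n, ∏ k ∈ Finset.Icc 1 n, ‖levelMask p D k (ξ + a)‖ ^ 2 = 1 := by
  have hP (n : ℕ) : moranProd p n ≠ 0 := moranProd_ne_zero (fun n hn => (hH n hn).ne_zero) n
  induction n with
  | zero => simp [spectrumLevel]
  | succ n ih =>
    rw [spectrumLevel, Finset.sum_image (injOn_add_moranProd_mul hH hD n), Finset.sum_product, ← ih]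
    refine Finset.sum_congr rfl fun a _ => ?_
    have hsplit (l : ℤ) :
        ∏ k ∈ Finset.Icc 1 (n + 1), ‖levelMask p D k (ξ + (a + moranProd p n * l : ℤ))‖ ^ 2 =
          (∏ k ∈ Finset.Icc 1 n, ‖levelMask p D k (ξ + a)‖ ^ 2) *
            ‖mask (D (n + 1)) ((ξ + a) / moranProd p (n + 1) + l / p (n + 1))‖ ^ 2 := by
      rw [Int.cast_add, Int.cast_mul, ← add_assoc, Finset.prod_Icc_succ_top n.succ_pos,
        levelMask_succ_add_mul (hP n)]
      congr 1
      refine Finset.prod_congr rfl fun k hk => ?_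
      rw [levelMask_add_mul_of_le (hP k) (Finset.mem_Icc.1 hk).2]
    simp only [hsplit]
    rw [← Finset.mul_sum, (hH _ n.succ_pos).sum_norm_mask_sq (hD _ n.succ_pos), mul_one]

variable {μ : ProbabilityMeasure ℝ} (hμ : IsMoranMeasure p D μ)
include hμ

theorem ft_sub_eq_zero_of_mem_spectrumUnion (h0 : ∀ n, 1 ≤ n → (0 : ℤ) ∈ L n) {a b : ℤ}
    (ha : a ∈ spectrumUnion p L) (hb : b ∈ spectrumUnion p L) (hab : a ≠ b) :
    ft (μ : Measure ℝ) (a - b) = 0 := by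
  obtain ⟨n, hn⟩ := Set.mem_iUnion.1 ha
  obtain ⟨m, hm⟩ := Set.mem_iUnion.1 hb
  have hmono := monotone_spectrumLevel (p := p) h0
  obtain ⟨k, hk, -, hz⟩ := exists_levelMask_sub_eq_zero hH (hmono (le_max_left n m) hn)
    (hmono (le_max_right n m) hm) hab
  exact hμ.ft_eq_zero (fun n hn => (hH n hn).ne_zero) hD hk hz

/- Parseval's identity for the partial convolutions passes to the limit by dominated convergence. -/
theorem hasSum_norm_ft_sq_of_prod_levelMask_le (h0 : ∀ n, 1 ≤ n → (0 : ℤ) ∈ L n) {ξ C : ℝ}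
    (hsum : Summable fun a : spectrumUnion p L => ‖ft (μ : Measure ℝ) (ξ + (a : ℤ))‖ ^ 2)
    (hdom : ∀ᶠ n in atTop, ∀ a ∈ spectrumLevel p L n,
      ∏ k ∈ Finset.Icc 1 n, ‖levelMask p D k (ξ + a)‖ ≤ C * ‖ft (μ : Measure ℝ) (ξ + a)‖) :
    HasSum (fun a : spectrumUnion p L => ‖ft (μ : Measure ℝ) (ξ + (a : ℤ))‖ ^ 2) 1 := by
  have hp (n : ℕ) (hn : 1 ≤ n) : p n ≠ 0 := (hH n hn).ne_zero
  let f (n : ℕ) (a : spectrumUnion p L) : ℝ := (spectrumLevel p L n : Set ℤ).indicator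
    (fun a => ∏ k ∈ Finset.Icc 1 n, ‖levelMask p D k (ξ + a)‖ ^ 2) a
  have htotal (n : ℕ) : ∑' a, f n a = 1 := by
    have hsub : (spectrumLevel p L n : Set ℤ) ⊆ spectrumUnion p L :=
      Set.subset_iUnion_of_subset n subset_rfl
    rw [tsum_subtype (spectrumUnion p L), Set.indicator_indicator,
      Set.inter_eq_self_of_subset_right hsub,
      ← sum_eq_tsum_indicator, sum_spectrumLevel_prod_levelMask hH hD]
  have hlim (a : spectrumUnion p L) :
      Tendsto (fun n => f n a) atTop (𝓝 (‖ft (μ : Measure ℝ) (ξ + (a : ℤ))‖ ^ 2)) := by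
    obtain ⟨n, hn⟩ := Set.mem_iUnion.1 a.2
    refine ((hμ.tendsto_prod_levelMask hp hD (ξ + (a : ℤ))).norm.pow 2).congr' ?_
    filter_upwards [eventually_ge_atTop n] with m hm
    have ham : (a : ℤ) ∈ (spectrumLevel p L m : Set ℤ) := monotone_spectrumLevel h0 hm hn
    simp only [f, Set.indicator_of_mem ham, norm_prod, Finset.prod_pow]
  have hbound : ∀ᶠ n in atTop, ∀ a : spectrumUnion p L,
      ‖f n a‖ ≤ C ^ 2 * ‖ft (μ : Measure ℝ) (ξ + (a : ℤ))‖ ^ 2 := by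
    filter_upwards [hdom] with n hn a
    by_cases ha : (a : ℤ) ∈ (spectrumLevel p L n : Set ℤ)
    · simp only [f, Set.indicator_of_mem ha, Finset.prod_pow, norm_pow, norm_prod, norm_norm,
        ← mul_pow]
      exact pow_le_pow_left₀ (Finset.prod_nonneg fun _ _ => norm_nonneg _) (hn a ha) 2
    · simp only [f, Set.indicator_of_notMem ha, norm_zero]
      positivity
  have hconv := tendsto_tsum_of_dominated_convergence (hsum.mul_left (C ^ 2)) hlim hbound
  simp only [htotal] at hconv
  rw [tendsto_nhds_unique tendsto_const_nhds hconv]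
  exact hsum.hasSum

theorem isSpectralMeasure_of_prod_levelMask_le (h0 : ∀ n, 1 ≤ n → (0 : ℤ) ∈ L n)
    (hdom : ∀ ξ : ℝ, ∃ C : ℝ, ∀ᶠ n in atTop, ∀ a ∈ spectrumLevel p L n,
      ∏ k ∈ Finset.Icc 1 n, ‖levelMask p D k (ξ + a)‖ ≤ C * ‖ft (μ : Measure ℝ) (ξ + a)‖) :
    IsSpectralMeasure μ := by
  have horth (a b : spectrumUnion p L) (hab : a ≠ b) :
      ft (μ : Measure ℝ) ((a : ℤ) - (b : ℤ)) = 0 :=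
    ft_sub_eq_zero_of_mem_spectrumUnion hH hD hμ h0 a.2 b.2 (Subtype.coe_ne_coe.2 hab)
  refine ⟨_, isSpectrum_range (l := fun a : spectrumUnion p L => ((a : ℤ) : ℝ)) horth fun ξ => ?_⟩
  obtain ⟨C, hC⟩ := hdom ξ
  refine hasSum_norm_ft_sq_of_prod_levelMask_le hH hD hμ h0 ?_ hC
  simp only [← norm_inner_expL2_neg]
  exact (orthonormal_expL2 horth).inner_products_summable _

end Spectrality

section SecondExample

theorem one_sixth_le_norm_mask_triple {a b : ℤ} (ha : a ≠ 0) (hb : b ≠ 0) (hab : a ≠ b) {x : ℝ}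
    (hx : |a * x| ≤ 1 / 16) : 1 / 6 ≤ ‖mask {0, a, b} x‖ := by
  have hclose : ‖(𝐞 (a * x) : ℂ) - 1‖ ≤ 1 / 2 :=
    (norm_fourierChar_sub_one_le _).trans (by nlinarith [Real.pi_lt_four, abs_nonneg (a * x)])
  have htri : (2 : ℝ) ≤ ‖1 + (𝐞 (a * x) : ℂ) + 𝐞 (b * x)‖ + ‖(𝐞 (a * x) : ℂ) - 1‖ + 1 := by
    have h2 : (2 : ℂ) =
        1 + (𝐞 (a * x) : ℂ) + 𝐞 (b * x) - ((𝐞 (a * x) : ℂ) - 1) - 𝐞 (b * x) := by ring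
    calc (2 : ℝ) = ‖(2 : ℂ)‖ := by simp
      _ ≤ _ := by
        rw [h2, ← Circle.norm_coe (𝐞 (b * x))]
        exact (norm_sub_le _ _).trans (add_le_add_left (norm_sub_le _ _) _)
  rw [mask_triple ha hb hab, norm_div, Complex.norm_ofNat]
  linarith

theorem pB_ne_zero {n : ℕ} (hn : 1 ≤ n) : pB n ≠ 0 := by
  rw [pB]
  omega

theorem nonempty_DB (n : ℕ) : (DB n).Nonempty := ⟨0, by simp [DB]⟩

theorem moranProd_pB_succ (n : ℕ) :
    (moranProd pB (n + 1) : ℝ) = 3 * (n + 1) * moranProd pB n := by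
  rw [moranProd_succ, pB]
  push_cast
  ring

theorem moranProd_pB_pos (n : ℕ) : (0 : ℝ) < moranProd pB n := by
  induction n with
  | zero => simp [moranProd]
  | succ n ih =>
    rw [moranProd_pB_succ]
    positivity

theorem three_pow_mul_moranProd_pB_le (n i : ℕ) :
    (3 : ℝ) ^ i * moranProd pB n ≤ moranProd pB (n + i) := by
  induction i with
  | zero => simp
  | succ i ih =>
    have hpos := moranProd_pB_pos (n + i)
    rw [← add_assoc, moranProd_pB_succ, pow_succ]
    push_cast
    nlinarith [mul_nonneg (add_nonneg n.cast_nonneg i.cast_nonneg : (0 : ℝ) ≤ n + i) hpos.le]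

theorem one_sixth_le_norm_levelMask_B {n k : ℕ} (hn : 22 ≤ n) (hnk : n < k) {x : ℝ}
    (hx : |x| ≤ 2 * moranProd pB n) : 1 / 6 ≤ ‖levelMask pB DB k x‖ := by
  have hk := moranProd_pB_pos k
  have hgrow : 3 * (n + 1 : ℝ) * moranProd pB n ≤ moranProd pB k := by
    obtain ⟨i, rfl⟩ := Nat.exists_eq_add_of_lt hnk
    rw [← moranProd_pB_succ, add_right_comm]
    refine le_trans ?_ (three_pow_mul_moranProd_pB_le (n + 1) i)
    exact le_mul_of_one_le_left (moranProd_pB_pos _).le (one_le_pow₀ (by norm_num))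
  have hn' : (22 : ℝ) ≤ n := by exact_mod_cast hn
  refine one_sixth_le_norm_mask_triple two_ne_zero (by positivity) (by omega) ?_
  rw [Int.cast_ofNat, abs_mul, abs_div, abs_two, abs_of_pos hk, ← mul_div_assoc,
    div_le_iff₀ hk]
  nlinarith [moranProd_pB_pos n]

theorem mul_sq_mul_moranProd_pB_le (n i : ℕ) :
    18 * (n + 3 + i : ℝ) ^ 2 * ((n + 1) * 3 ^ i * moranProd pB n) ≤ moranProd pB (n + 3 + i) := by
  have hstep := three_pow_mul_moranProd_pB_le (n + 1) i
  have hpos := moranProd_pB_pos (n + 1 + i)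
  rw [moranProd_pB_succ] at hstep
  set k : ℝ := n + 3 + i with hk
  have hk3 : 3 ≤ k := by
    rw [hk, add_right_comm]
    exact le_add_of_nonneg_left (by positivity)
  calc 18 * k ^ 2 * ((n + 1) * 3 ^ i * moranProd pB n)
      = 6 * k ^ 2 * (3 ^ i * (3 * (n + 1) * moranProd pB n)) := by ring
    _ ≤ 6 * k ^ 2 * moranProd pB (n + 1 + i) := by gcongr
    _ ≤ 9 * k * (k - 1) * moranProd pB (n + 1 + i) := by gcongr ?_ * _; nlinarith [hk3]
    _ = moranProd pB (n + 3 + i) := by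
      rw [show n + 3 + i = n + 1 + i + 1 + 1 by ring, moranProd_pB_succ, moranProd_pB_succ, hk]
      push_cast
      ring

theorem abs_le_of_mem_DB {k : ℕ} (hk : 1 ≤ k) {d : ℤ} (hd : d ∈ DB k) :
    |(d : ℝ)| ≤ 4 * k ^ 2 := by
  have hk' : (1 : ℝ) ≤ k := by exact_mod_cast hk
  simp only [DB, Finset.mem_insert, Finset.mem_singleton] at hd
  rcases hd with rfl | rfl | rfl
  · simp
  · norm_num
    nlinarith
  · push_cast
    rw [abs_of_nonneg (by positivity)]
    nlinarith

theorem norm_levelMask_B_sub_one_le {n : ℕ} (i : ℕ) {x : ℝ} (hx : |x| ≤ 2 * moranProd pB n) :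
    ‖levelMask pB DB (n + 3 + i) x - 1‖ ≤ 3 / (n + 1) * (1 / 3) ^ i := by
  have hP := moranProd_pB_pos (n + 3 + i)
  have hdigit : ∀ d ∈ DB (n + 3 + i), |(d : ℝ) * (x / moranProd pB (n + 3 + i))| ≤
      4 / (9 * ((n + 1) * 3 ^ i)) := by
    intro d hd
    have hd4 := abs_le_of_mem_DB (by omega) hd
    push_cast at hd4
    rw [abs_mul, abs_div, abs_of_pos hP, ← mul_div_assoc, div_le_div_iff₀ hP (by positivity)]
    calc |(d : ℝ)| * |x| * (9 * ((n + 1) * 3 ^ i))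
        ≤ 4 * (n + 3 + i) ^ 2 * (2 * moranProd pB n) * (9 * ((n + 1) * 3 ^ i)) := by gcongr
      _ = 4 * (18 * (n + 3 + i) ^ 2 * ((n + 1) * 3 ^ i * moranProd pB n)) := by ring
      _ ≤ 4 * moranProd pB (n + 3 + i) := by
        gcongr
        exact mul_sq_mul_moranProd_pB_le n i
  refine (norm_mask_sub_one_le (nonempty_DB _) hdigit).trans ?_
  rw [one_div_pow, div_mul_div_comm, mul_one, ← mul_div_assoc, div_le_div_iff₀ (by positivity)
    (by positivity)]
  have hpos : (0 : ℝ) < (n + 1) * 3 ^ i := by positivity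
  nlinarith [Real.pi_lt_d2]

theorem prod_levelMask_B_le {μ : ProbabilityMeasure ℝ} (hμ : IsMoranMeasure pB DB μ) {n : ℕ}
    (hn : 22 ≤ n) {x : ℝ} (hx : |x| ≤ 2 * moranProd pB n) :
    ∏ k ∈ Finset.Icc 1 n, ‖levelMask pB DB k x‖ ≤ 72 * ‖ft (μ : Measure ℝ) x‖ := by
  have htail (m : ℕ) : ∑ k ∈ Finset.Ioc (n + 2) m, ‖levelMask pB DB k x - 1‖ ≤ 1 / 2 := by
    have hgeom (s : Finset ℕ) : ∑ i ∈ s, (1 / 3 : ℝ) ^ i ≤ 3 / 2 := by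
      have hs := (summable_geometric_of_lt_one (by norm_num) (by norm_num : (1 / 3 : ℝ) < 1))
      have := hs.sum_le_tsum s fun _ _ => by positivity
      rw [tsum_geometric_of_lt_one (by norm_num) (by norm_num)] at this
      linarith
    have hn' : (22 : ℝ) ≤ n := by exact_mod_cast hn
    rw [← Finset.Ico_add_one_add_one_eq_Ioc, Finset.sum_Ico_eq_sum_range]
    refine (Finset.sum_le_sum fun i _ => norm_levelMask_B_sub_one_le i hx).trans ?_
    have hfrac : 3 / ((n : ℝ) + 1) ≤ 1 / 3 := by
      rw [div_le_iff₀ (by positivity)]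
      linarith
    rw [← Finset.mul_sum]
    calc _ ≤ 1 / 3 * (3 / 2 : ℝ) := mul_le_mul hfrac (hgeom _) (by positivity) (by norm_num)
      _ = 1 / 2 := by norm_num
  have hhalf := hμ.half_prod_le_norm_ft (fun _ => pB_ne_zero) (fun n _ => nonempty_DB n) htail
  rw [Finset.prod_Icc_succ_top (by omega), Finset.prod_Icc_succ_top (by omega)] at hhalf
  have hmid : 1 / 6 * (1 / 6) ≤ ‖levelMask pB DB (n + 1) x‖ * ‖levelMask pB DB (n + 2) x‖ :=
    mul_le_mul (one_sixth_le_norm_levelMask_B hn (by omega) hx)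
      (one_sixth_le_norm_levelMask_B hn (by omega) hx) (by norm_num) (norm_nonneg _)
  have hpos : 0 ≤ ∏ k ∈ Finset.Icc 1 n, ‖levelMask pB DB k x‖ :=
    Finset.prod_nonneg fun _ _ => norm_nonneg _
  nlinarith [mul_le_mul_of_nonneg_left hmid hpos]

theorem isHadamardTriple_B {n : ℕ} (hn : 1 ≤ n) :
    IsHadamardTriple (pB n) (DB n) ((Finset.range 3).image fun c : ℕ => (n : ℤ) * c) := by
  refine isHadamardTriple_of_not_dvd (N := 3) ?_ ?_ ?_
  · rw [abs_of_pos (by positivity)]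
    push_cast
    omega
  · exact Finset.card_eq_three.2 ⟨0, 2, 3 * (n : ℤ) ^ 2 + 1, by omega, by omega, by omega, rfl⟩
  · intro d hd d' hd' hne
    simp only [DB, Finset.mem_insert, Finset.mem_singleton] at hd hd'
    rcases hd with rfl | rfl | rfl <;> rcases hd' with rfl | rfl | rfl <;> omega

theorem isSpectralMeasure_of_isMoranMeasure_B {μ : ProbabilityMeasure ℝ}
    (hμ : IsMoranMeasure pB DB μ) : IsSpectralMeasure μ := by
  refine isSpectralMeasure_of_prod_levelMask_le (fun n hn => isHadamardTriple_B hn)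
    (fun n _ => nonempty_DB n) hμ (fun n _ => Finset.mem_image.2 ⟨0, by simp⟩) fun ξ => ⟨72, ?_⟩
  have hlarge : ∀ᶠ n in atTop, |ξ| ≤ moranProd pB n := by
    obtain ⟨N, hN⟩ := exists_nat_ge |ξ|
    filter_upwards [eventually_ge_atTop N] with n hn
    have hpow := three_pow_mul_moranProd_pB_le 0 n
    have hlt : (n : ℝ) < 3 ^ n := by exact_mod_cast Nat.lt_pow_self (by norm_num : 1 < 3)
    have hNn : (N : ℝ) ≤ n := by exact_mod_cast hn
    rw [zero_add, show moranProd pB 0 = 1 from rfl, Int.cast_one, mul_one] at hpow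
    linarith
  filter_upwards [hlarge, eventually_ge_atTop 22] with n hξ hn a ha
  have ha' : |(a : ℝ)| ≤ moranProd pB n := by
    have hI := mem_Ico_of_mem_spectrumLevel (p := pB) (fun n hn l hl => ?_) ha
    · rw [abs_of_nonneg (by exact_mod_cast (Finset.mem_Ico.1 hI).1)]
      exact_mod_cast (Finset.mem_Ico.1 hI).2.le
    · obtain ⟨c, hc, rfl⟩ := Finset.mem_image.1 hl
      have := Finset.mem_range.1 hc
      rw [Finset.mem_Ico, pB]
      constructor
      · positivity
      · nlinarith
  exact prod_levelMask_B_le hμ hn ((abs_add_le _ _).trans (by linarith))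

end SecondExample

section Far

/-- The distance of `x` to the integers is at least `1 / 18`. The constant must be below `1 / 13`
in `nine_mul_round_eq_of_not_far`, and `1 / 18` is the largest one possible in `InLayer.far`. -/
def Far (x : ℝ) : Prop := ∀ n : ℤ, 1 / 18 ≤ |x - n|

theorem far_add_intCast {x : ℝ} (m : ℤ) : Far (x + m) ↔ Far x := by
  refine ⟨fun h n => ?_, fun h n => ?_⟩
  · have := h (n + m)
    rwa [Int.cast_add, add_sub_add_right_eq_sub] at this
  · have := h (n - m)
    rwa [Int.cast_sub, sub_sub_eq_add_sub] at this

theorem not_far_iff {x : ℝ} : ¬ Far x ↔ |x - round x| < 1 / 18 := by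
  rw [Far]
  push Not
  exact ⟨fun ⟨n, hn⟩ => (round_le x n).trans_lt hn, fun h => ⟨_, h⟩⟩

theorem norm_one_add_fourierChar_le_of_far {x : ℝ} (hx : Far x) :
    ‖1 + (𝐞 x : ℂ)‖ ≤ 199 / 100 := by
  set y := x - round x with hy
  have hxy : 𝐞 x = 𝐞 y := by
    rw [← fourierChar_add_intCast y (round x), hy, sub_add_cancel]
  have hfar : 1 / 18 ≤ |y| := hx (round x)
  have hhalf : |y| ≤ 1 / 2 := abs_sub_round x
  have hcos : Real.cos (2 * Real.pi * y) ≤ 1 - 8 * y ^ 2 := by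
    have hle : |2 * Real.pi * y| ≤ Real.pi := by
      rw [abs_mul, abs_of_pos Real.two_pi_pos]
      nlinarith [Real.pi_pos]
    refine (Real.cos_le_one_sub_mul_cos_sq hle).trans (le_of_eq ?_)
    field_simp
    ring
  have hsq : ‖1 + (𝐞 y : ℂ)‖ ^ 2 = 2 + 2 * Real.cos (2 * Real.pi * y) := by
    rw [← Complex.normSq_eq_norm_sq, Complex.normSq_add, Complex.normSq_one,
      Complex.normSq_eq_norm_sq, Circle.norm_coe, one_mul, Complex.conj_re, re_fourierChar]
    ring
  have hy2 : (1 / 18 : ℝ) ^ 2 ≤ y ^ 2 := by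
    rw [← sq_abs y]
    gcongr
  rw [hxy]
  refine le_of_sq_le_sq ?_ (by norm_num)
  rw [hsq]
  linarith

theorem norm_mask_triple_le_of_far {a b : ℤ} (ha : a ≠ 0) (hb : b ≠ 0) (hab : a ≠ b) {x : ℝ}
    (h : Far (a * x) ∨ Far (b * x)) : ‖mask {0, a, b} x‖ ≤ 299 / 300 := by
  have hsum {z w : ℂ} (hz : ‖1 + z‖ ≤ 199 / 100) (hw : ‖w‖ = 1) : ‖1 + z + w‖ ≤ 299 / 100 :=
    (norm_add_le _ _).trans (by linarith)
  rw [mask_triple ha hb hab, norm_div, Complex.norm_ofNat, div_le_iff₀ three_pos]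
  norm_num only
  rcases h with h | h
  · exact hsum (norm_one_add_fourierChar_le_of_far h) (Circle.norm_coe _)
  · rw [add_right_comm]
    exact hsum (norm_one_add_fourierChar_le_of_far h) (Circle.norm_coe _)

end Far

section Orbit

theorem abs_nine_mul_round_sub_le (u : ℝ) :
    |9 * round (u * (4 / 9)) - 4 * round u| ≤ 6 := by
  have h1 := abs_le.1 (abs_sub_round u)
  have h2 := abs_le.1 (abs_sub_round (u * (4 / 9)))
  refine Int.lt_add_one_iff.1 (Int.cast_lt (R := ℝ).1 ?_)
  push_cast
  rw [abs_lt]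
  constructor <;> linarith [h1.1, h1.2, h2.1, h2.2]

theorem nine_mul_round_eq_of_not_far {u : ℝ} (h1 : ¬ Far u) (h2 : ¬ Far (u * (4 / 9))) :
    9 * round (u * (4 / 9)) = 4 * round u := by
  rw [not_far_iff, abs_lt] at h1 h2
  refine sub_eq_zero.1 (Int.abs_lt_one_iff.1 (Int.cast_lt (R := ℝ).1 ?_))
  push_cast
  rw [abs_lt]
  constructor <;> linarith [h1.1, h1.2, h2.1, h2.2]

theorem nine_pow_dvd_round {u : ℝ} {J : ℕ} (h : ∀ i ≤ J, ¬ Far (u * (4 / 9) ^ i)) :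
    (9 : ℤ) ^ J ∣ round u := by
  have hstep : ∀ i ≤ J, 9 ^ i * round (u * (4 / 9) ^ i) = 4 ^ i * round u := by
    intro i hi
    induction i with
    | zero => simp
    | succ i ih =>
      have hnext : u * (4 / 9) ^ (i + 1) = u * (4 / 9) ^ i * (4 / 9) := by
        rw [pow_succ, mul_assoc]
      have hround := nine_mul_round_eq_of_not_far (h i (by omega)) (hnext ▸ h (i + 1) hi)
      rw [hnext]
      linear_combination 9 ^ i * hround + 4 * ih (by omega)
  have hcop : IsCoprime ((9 : ℤ) ^ J) (4 ^ J) := IsCoprime.pow (by norm_num)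
  exact hcop.dvd_of_dvd_mul_left ⟨_, (hstep J le_rfl).symm⟩

theorem exists_far_of_lt_nine_pow {u : ℝ} (hu : 1 ≤ |u|) {J : ℕ} (hJ : |u| + 1 / 2 < 9 ^ J) :
    ∃ i ≤ J, Far (u * (4 / 9) ^ i) := by
  by_contra! hcon
  have hr := abs_le.1 (abs_sub_round u)
  have hne : round u ≠ 0 := by
    intro h0
    rw [h0, Int.cast_zero, sub_zero] at hr
    linarith [abs_le.2 hr]
  have hle : (9 : ℝ) ^ J ≤ |(round u : ℝ)| := by
    exact_mod_cast Int.le_of_dvd (abs_pos.2 hne) ((dvd_abs _ _).2 (nine_pow_dvd_round hcon))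
  have hround := abs_sub_abs_le_abs_sub (round u : ℝ) u
  rw [abs_sub_comm] at hround
  linarith [abs_sub_round u]

/-- The number of points of the orbit segment `u, (4/9) u, …, (4/9)ⁿ⁻¹ u` that are far from the
integers. -/
def orbitFarCount (n : ℕ) (u : ℝ) : ℕ :=
  open Classical in ((Finset.range n).filter fun i => Far (u * (4 / 9) ^ i)).card

theorem orbitFarCount_add_one_le {u : ℝ} {m n : ℕ} (h : ∃ i < m, Far (u * (4 / 9) ^ i)) :
    orbitFarCount n (u * (4 / 9) ^ m) + 1 ≤ orbitFarCount (m + n) u := by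
  classical
  obtain ⟨i, hi, hfar⟩ := h
  have hsub : insert i (((Finset.range n).filter fun l =>
      Far (u * (4 / 9) ^ m * (4 / 9) ^ l)).map (addLeftEmbedding m)) ⊆
      (Finset.range (m + n)).filter fun l => Far (u * (4 / 9) ^ l) := by
    refine Finset.insert_subset ?_ fun l hl => ?_
    · exact Finset.mem_filter.2 ⟨Finset.mem_range.2 (by omega), hfar⟩
    · obtain ⟨a, ha, rfl⟩ := Finset.mem_map.1 hl
      rw [Finset.mem_filter, Finset.mem_range, mul_assoc, ← pow_add] at ha
      exact Finset.mem_filter.2 ⟨Finset.mem_range.2 (Nat.add_lt_add_left ha.1 m), ha.2⟩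
  have hcard := Finset.card_le_card hsub
  rw [Finset.card_insert_of_notMem, Finset.card_map] at hcard
  · unfold orbitFarCount
    convert hcard
  · simp only [Finset.mem_map, addLeftEmbedding_apply, not_exists, not_and]
    intro a _
    omega

theorem mul_abs_le_sq_of_nine_pow_le {u : ℝ} {J : ℕ} (hJ : (9 : ℝ) ^ J ≤ 18 * |u|) :
    1600 * |u| ≤ (1600 * |u * (4 / 9) ^ (J + 1)|) ^ 2 := by
  have hpow : (1 : ℝ) ≤ 9 ^ (J + 1) * ((4 / 9) ^ (J + 1)) ^ 2 := by
    rw [← pow_mul, mul_comm (J + 1), pow_mul, ← mul_pow]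
    exact one_le_pow₀ (by norm_num)
  have hle : (1 : ℝ) ≤ 162 * |u| * ((4 / 9) ^ (J + 1)) ^ 2 := by
    refine hpow.trans ?_
    gcongr
    rw [pow_succ]
    linarith
  rw [abs_mul, abs_of_pos (by positivity : (0 : ℝ) < (4 / 9) ^ (J + 1))]
  nlinarith [mul_le_mul_of_nonneg_left hle (abs_nonneg u)]

/-- The orbit of `u` is far from the integers at least `log log |u|` times: a far point occurs
before time `log₉ |u| + 2`, and at that time the orbit has only shrunk to about `√|u|`. -/
theorem exists_le_orbitFarCount (b : ℕ) {u : ℝ} (hu : (1600 : ℝ) ^ (2 ^ b) ≤ 1600 * |u|) :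
    ∃ n, b ≤ orbitFarCount n u := by
  induction b generalizing u with
  | zero => exact ⟨0, Nat.zero_le _⟩
  | succ b ih =>
    have hu1 : 1600 ≤ |u| := by
      have : (1600 : ℝ) ^ 2 ≤ 1600 ^ (2 ^ (b + 1)) :=
        pow_le_pow_right₀ (by norm_num) (Nat.le_pow b.succ_pos)
      linarith
    obtain ⟨J, hJ, hJ'⟩ :=
      exists_nat_pow_near (x := 2 * |u|) (y := 9) (by linarith) (by norm_num)
    obtain ⟨i, hi, hfar⟩ := exists_far_of_lt_nine_pow (J := J + 1) (by linarith) (by linarith)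
    have hroot : (1600 : ℝ) ^ (2 ^ b) ≤ 1600 * |u * (4 / 9) ^ (J + 1 + 1)| := by
      refine le_of_sq_le_sq ?_ (by positivity)
      rw [← pow_mul, ← pow_succ]
      exact hu.trans (mul_abs_le_sq_of_nine_pow_le (by rw [pow_succ]; linarith))
    obtain ⟨n, hn⟩ := ih hroot
    exact ⟨J + 1 + 1 + n, (Nat.succ_le_succ hn).trans
      (orbitFarCount_add_one_le ⟨i, Nat.lt_succ_of_le hi, hfar⟩)⟩

end Orbit

section NearlyGeometric

variable (a b : ℤ) (r : ℕ) (z : ℤ)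

/-- The possible values of `m 0` for integer sequences with `m n = z` in which
`|a * m (i + 1) - b * m i| ≤ r` for all `i < n`, with at most `c` values of `i` where the
difference is nonzero. -/
def startValues : ℕ → ℕ → Finset ℤ
  | 0, _ => {z}
  | n + 1, 0 => (startValues n 0).image fun y => a * y / b
  | n + 1, c + 1 => ((startValues n (c + 1)).image fun y => a * y / b) ∪
      (startValues n c ×ˢ (Finset.Icc (-r : ℤ) r).erase 0).image fun w => (a * w.1 - w.2) / b

theorem card_startValues_le (n c : ℕ) :
    (startValues a b r z n c).card ≤ (2 * r * n + 1) ^ c := by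
  induction n generalizing c with
  | zero => simp [startValues]
  | succ n ih =>
    cases c with
    | zero => exact Finset.card_image_le.trans (by simpa using ih 0)
    | succ c =>
      have hpairs : (startValues a b r z n c ×ˢ (Finset.Icc (-r : ℤ) r).erase 0).card ≤
          (2 * r * n + 1) ^ c * (2 * r) := by
        rw [Finset.card_product, Finset.card_erase_of_mem (by simp), Int.card_Icc]
        exact Nat.mul_le_mul (ih c) (by omega)
      calc (startValues a b r z (n + 1) (c + 1)).card
          ≤ (2 * r * n + 1) ^ (c + 1) + (2 * r * n + 1) ^ c * (2 * r) :=
            (Finset.card_union_le _ _).trans (Nat.add_le_add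
              (Finset.card_image_le.trans (ih _)) (Finset.card_image_le.trans hpairs))
        _ = (2 * r * n + 1) ^ c * (2 * r * (n + 1) + 1) := by ring
        _ ≤ (2 * r * (n + 1) + 1) ^ c * (2 * r * (n + 1) + 1) := by gcongr; omega
        _ = (2 * r * (n + 1) + 1) ^ (c + 1) := (pow_succ _ _).symm

variable {a b r z}

theorem mem_startValues (hb : b ≠ 0) {n c : ℕ} {m : ℕ → ℤ} (hz : m n = z)
    (hr : ∀ i < n, |a * m (i + 1) - b * m i| ≤ r)
    (hc : ((Finset.range n).filter fun i => a * m (i + 1) ≠ b * m i).card ≤ c) :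
    m 0 ∈ startValues a b r z n c := by
  induction n generalizing c m with
  | zero => simp [startValues, hz]
  | succ n ih =>
    have hcount : ((Finset.range (n + 1)).filter fun i => a * m (i + 1) ≠ b * m i).card =
        ((Finset.range n).filter fun i => a * m (i + 1 + 1) ≠ b * m (i + 1)).card +
          if a * m 1 ≠ b * m 0 then 1 else 0 := by
      rw [Finset.card_filter, Finset.card_filter, Finset.sum_range_succ']
    rw [hcount] at hc
    have htail {c' : ℕ} := ih (c := c') (m := fun i => m (i + 1)) hz
      fun i hi => hr (i + 1) (Nat.succ_lt_succ hi)
    by_cases h0 : a * m 1 = b * m 0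
    · rw [if_neg (not_not.2 h0), add_zero] at hc
      have hmem : m 0 ∈ (startValues a b r z n c).image fun y => a * y / b :=
        Finset.mem_image.2 ⟨m 1, htail hc, by simp only [h0, Int.mul_ediv_cancel_left _ hb]⟩
      cases c with
      | zero => exact hmem
      | succ c => exact Finset.mem_union_left _ hmem
    · rw [if_pos h0] at hc
      obtain ⟨c, rfl⟩ := Nat.exists_eq_add_of_le' ((Nat.le_add_left _ _).trans hc)
      have herr : a * m 1 - b * m 0 ∈ (Finset.Icc (-r : ℤ) r).erase 0 :=
        Finset.mem_erase.2 ⟨sub_ne_zero.2 h0, Finset.mem_Icc.2 (abs_le.1 (hr 0 n.succ_pos))⟩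
      refine Finset.mem_union_right _ (Finset.mem_image.2 ⟨(m 1, a * m 1 - b * m 0),
        Finset.mem_product.2 ⟨htail (Nat.le_of_succ_le_succ hc), herr⟩, ?_⟩)
      simp only [sub_sub_cancel, Int.mul_ediv_cancel_left _ hb]

end NearlyGeometric

section OrbitRounding

theorem card_filter_round_ne_le (u : ℝ) (n : ℕ) :
    ((Finset.range n).filter fun i =>
      9 * round (u * (4 / 9) ^ (i + 1)) ≠ 4 * round (u * (4 / 9) ^ i)).card ≤
      2 * orbitFarCount (n + 1) u := by
  classical
  set A := (Finset.range (n + 1)).filter fun i => Far (u * (4 / 9) ^ i) with hA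
  have hsub : ((Finset.range n).filter fun i =>
      9 * round (u * (4 / 9) ^ (i + 1)) ≠ 4 * round (u * (4 / 9) ^ i)) ⊆ A ∪ A.image (· - 1) := by
    intro i hi
    rw [Finset.mem_filter, Finset.mem_range, pow_succ, ← mul_assoc] at hi
    have hor : Far (u * (4 / 9) ^ i) ∨ Far (u * (4 / 9) ^ i * (4 / 9)) := by
      by_contra! hcon
      exact hi.2 (nine_mul_round_eq_of_not_far hcon.1 hcon.2)
    rw [mul_assoc, ← pow_succ] at hor
    simp only [hA, Finset.mem_union, Finset.mem_image, Finset.mem_filter, Finset.mem_range]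
    exact hor.imp (fun h => ⟨by omega, h⟩) fun h => ⟨i + 1, ⟨by omega, h⟩, rfl⟩
  calc _ ≤ (A ∪ A.image (· - 1)).card := Finset.card_le_card hsub
    _ ≤ A.card + A.card :=
      (Finset.card_union_le _ _).trans (Nat.add_le_add_left Finset.card_image_le _)
    _ = 2 * orbitFarCount (n + 1) u := by
      rw [← two_mul, hA]
      unfold orbitFarCount
      congr!

theorem round_mem_startValues {u : ℝ} {n c : ℕ} (hend : |u * (4 / 9) ^ n| < 1 / 2)
    (hc : orbitFarCount (n + 1) u ≤ c) : round u ∈ startValues 9 4 6 0 n (2 * c) := by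
  have hmem := mem_startValues (a := 9) (b := 4) (r := 6) (z := 0) four_ne_zero
    (m := fun i => round (u * (4 / 9) ^ i)) (n := n) (c := 2 * c) ?_ (fun i _ => ?_)
    ((card_filter_round_ne_le u n).trans (Nat.mul_le_mul_left 2 hc))
  · simpa only [pow_zero, mul_one] using hmem
  · exact round_eq_zero_iff.2 ⟨(abs_lt.1 hend).1.le, (abs_lt.1 hend).2⟩
  · simp only [pow_succ, ← mul_assoc]
    exact abs_nine_mul_round_sub_le _

end OrbitRounding

section FirstExample

theorem moranProd_pA (n : ℕ) : moranProd pA n = 9 ^ n := by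
  simp [moranProd, pA]

theorem pA_ne_zero (n : ℕ) : pA n ≠ 0 := by
  norm_num [pA]

theorem nonempty_DA (n : ℕ) : (DA n).Nonempty := ⟨0, by simp [DA]⟩

theorem two_ne_four_pow (n : ℕ) : (2 : ℤ) ≠ 4 ^ n := by
  cases n with
  | zero => norm_num
  | succ n => rw [pow_succ]; omega

theorem levelMask_A (k : ℕ) (t : ℝ) : levelMask pA DA k t = mask {0, 2, 4 ^ k} (t / 9 ^ k) := by
  rw [levelMask, moranProd_pA, DA]
  push_cast
  rfl

theorem exists_eq_of_levelMask_A_eq_zero {k : ℕ} {t : ℝ} (h : levelMask pA DA k t = 0) :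
    ∃ j : ℤ, ¬ (3 : ℤ) ∣ j ∧ t = 9 ^ k * j / 6 := by
  rw [levelMask_A] at h
  obtain ⟨j, hj, h⟩ := exists_eq_div_three_of_mask_triple_eq_zero two_ne_zero (by positivity)
    (two_ne_four_pow k) h
  refine ⟨j, hj, ?_⟩
  push_cast at h
  field_simp at h ⊢
  linarith

theorem le_abs_of_levelMask_A_eq_zero {k : ℕ} {t : ℝ} (h : levelMask pA DA k t = 0) :
    9 ^ k / 6 ≤ |t| := by
  obtain ⟨j, hj, rfl⟩ := exists_eq_of_levelMask_A_eq_zero h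
  have hj1 : (1 : ℝ) ≤ |(j : ℝ)| := by
    exact_mod_cast Int.one_le_abs (by rintro rfl; simp at hj)
  rw [abs_div, abs_mul, abs_of_pos (by positivity : (0 : ℝ) < 9 ^ k), Nat.abs_ofNat]
  gcongr
  exact le_mul_of_one_le_right (by positivity) hj1

theorem le_of_levelMask_A_eq_zero {k n : ℕ} {t : ℝ} (h : levelMask pA DA k t = 0)
    (ht : |t| < 9 ^ (n + 1) / 6) : k ≤ n := by
  have hpow : (9 : ℝ) ^ k < 9 ^ (n + 1) := by linarith [le_abs_of_levelMask_A_eq_zero h]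
  exact Nat.lt_succ_iff.1 ((pow_lt_pow_iff_right₀ (by norm_num)).1 hpow)

/-- The squared absolute value of the Fourier transform of the finite convolution `μ_K` of the
first example. -/
def weightA (K : ℕ) (t : ℝ) : ℝ := ∏ k ∈ Finset.Icc 1 K, ‖levelMask pA DA k t‖ ^ 2

theorem weightA_nonneg (K : ℕ) (t : ℝ) : 0 ≤ weightA K t :=
  Finset.prod_nonneg fun _ _ => by positivity

/-- The bound for the squared absolute value of a ternary mask at points far from the integers. -/
def rho : ℝ := (299 / 300) ^ 2

theorem rho_pos : 0 < rho := by norm_num [rho]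

theorem rho_lt_one : rho < 1 := by norm_num [rho]

theorem norm_levelMask_A_sq_le_of_far {k : ℕ} {t : ℝ}
    (h : Far (2 * t / 9 ^ k) ∨ Far (t * (4 / 9) ^ k)) : ‖levelMask pA DA k t‖ ^ 2 ≤ rho := by
  rw [levelMask_A, rho]
  gcongr
  refine norm_mask_triple_le_of_far two_ne_zero (by positivity) (two_ne_four_pow k) ?_
  push_cast
  rwa [← mul_div_assoc, mul_div_left_comm, ← div_pow]

theorem weightA_le_mul_rho_pow {K n : ℕ} (hKn : K ≤ n) {B : Finset ℕ} (hB : B ⊆ Finset.Ioc K n)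
    {t : ℝ} (hfar : ∀ k ∈ B, Far (2 * t / 9 ^ k) ∨ Far (t * (4 / 9) ^ k)) :
    weightA n t ≤ weightA K t * rho ^ B.card := by
  have hIcc (m : ℕ) : Finset.Icc 1 m = Finset.Ioc 0 m := Finset.Icc_add_one_left_eq_Ioc 0 m
  rw [weightA, weightA, hIcc, hIcc, ← Finset.prod_Ioc_consecutive _ K.zero_le hKn, ← hIcc]
  refine mul_le_mul_of_nonneg_left ?_ (weightA_nonneg K t)
  calc ∏ k ∈ Finset.Ioc K n, ‖levelMask pA DA k t‖ ^ 2
      ≤ ∏ k ∈ B, ‖levelMask pA DA k t‖ ^ 2 :=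
        Finset.prod_le_prod_of_subset_of_le_one hB (fun _ _ => by positivity) fun k _ _ =>
          pow_le_one₀ (norm_nonneg _) (norm_levelMask_le_one _ _ _ _)
    _ ≤ ∏ _k ∈ B, rho := Finset.prod_le_prod (fun _ _ => by positivity) fun k hk =>
        norm_levelMask_A_sq_le_of_far (hfar k hk)
    _ = rho ^ B.card := Finset.prod_const _

theorem weightA_le_mul_rho_pow_orbitFarCount (K n : ℕ) (t : ℝ) :
    weightA (K + n) t ≤ weightA K t * rho ^ orbitFarCount n (t * (4 / 9) ^ (K + 1)) := by
  classical
  have h := weightA_le_mul_rho_pow (t := t) (Nat.le_add_right K n)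
    (B := ((Finset.range n).filter fun i => Far (t * (4 / 9) ^ (K + 1) * (4 / 9) ^ i)).map
      (addLeftEmbedding (K + 1))) (fun k hk => ?_) (fun k hk => ?_)
  · rw [Finset.card_map] at h
    unfold orbitFarCount
    convert h
  · obtain ⟨i, hi, rfl⟩ := Finset.mem_map.1 hk
    have := Finset.mem_range.1 (Finset.mem_filter.1 hi).1
    rw [addLeftEmbedding_apply, Finset.mem_Ioc]
    omega
  · obtain ⟨i, hi, rfl⟩ := Finset.mem_map.1 hk
    have hfar := (Finset.mem_filter.1 hi).2
    rw [mul_assoc, ← pow_add] at hfar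
    exact Or.inr hfar

/-- `t` lies in the layer `K`: the frequencies at which the masks of level at most `K` oscillate,
while the digit `2` still keeps the mask of level `K` away from `1`. -/
def InLayer (K : ℕ) (t : ℝ) : Prop := 9 ^ K / 36 < |t| ∧ |t| ≤ 9 ^ K / 4

theorem InLayer.far {K : ℕ} {t : ℝ} (h : InLayer K t) : Far (2 * t / 9 ^ K) := by
  have hK : (0 : ℝ) < 9 ^ K := by positivity
  have habs : |2 * t / 9 ^ K| = 2 * |t| / 9 ^ K := by
    rw [abs_div, abs_mul, abs_two, abs_of_pos hK]
  have hlower : 1 / 18 < |2 * t / 9 ^ K| := by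
    rw [habs, lt_div_iff₀ hK]
    linarith [h.1]
  have hupper : |2 * t / 9 ^ K| ≤ 1 / 2 := by
    rw [habs, div_le_iff₀ hK]
    linarith [h.2]
  intro n
  rcases eq_or_ne n 0 with rfl | hn
  · simpa using hlower.le
  · have hn1 : (1 : ℝ) ≤ |(n : ℝ)| := by exact_mod_cast Int.one_le_abs hn
    have htri := abs_sub_abs_le_abs_sub (n : ℝ) (2 * t / 9 ^ K)
    rw [abs_sub_comm] at htri
    linarith

theorem InLayer.level_le {K k : ℕ} {s t : ℝ} (hs : InLayer K s) (ht : InLayer K t)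
    (hz : levelMask pA DA k (t - s) = 0) : k ≤ K := by
  refine le_of_levelMask_A_eq_zero hz ((abs_sub t s).trans_lt ?_)
  rw [pow_succ]
  linarith [hs.2, ht.2, pow_pos (by norm_num : (0 : ℝ) < 9) K]

theorem InLayer.exists_le_orbitFarCount {K b : ℕ} (hb : 6 * 2 ^ b ≤ K) {t : ℝ}
    (ht : InLayer K t) : ∃ n, b ≤ orbitFarCount n (t * (4 / 9) ^ (K + 1)) := by
  refine CantorMoran.exists_le_orbitFarCount b ?_
  have hlower : (4 : ℝ) ^ K / 81 ≤ |t * (4 / 9) ^ (K + 1)| := by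
    rw [abs_mul, abs_of_pos (by positivity : (0 : ℝ) < (4 / 9) ^ (K + 1))]
    calc (4 : ℝ) ^ K / 81 = 9 ^ K / 36 * (4 / 9) ^ (K + 1) := by
          rw [pow_succ, div_pow]
          field_simp
          norm_num
      _ ≤ |t| * (4 / 9) ^ (K + 1) := by
          gcongr
          exact ht.1.le
  calc (1600 : ℝ) ^ (2 ^ b) ≤ (4 ^ 6) ^ (2 ^ b) := by gcongr; norm_num
    _ = 4 ^ (6 * 2 ^ b) := by rw [← pow_mul]
    _ ≤ 4 ^ K := pow_le_pow_right₀ (by norm_num) hb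
    _ ≤ 1600 * |t * (4 / 9) ^ (K + 1)| := by
      linarith [pow_pos (by norm_num : (0 : ℝ) < 4) K]

theorem InLayer.round_mem_startValues {K b : ℕ} (hK : 1 ≤ K) {t : ℝ} (ht : InLayer K t)
    (hb : orbitFarCount (2 * K) (t * (4 / 9) ^ (K + 1)) ≤ b) :
    round (t * (4 / 9) ^ (K + 1)) ∈ startValues 9 4 6 0 (2 * K - 1) (2 * b) := by
  refine CantorMoran.round_mem_startValues ?_ (by rwa [Nat.sub_add_cancel (by omega)])
  rw [mul_assoc, ← pow_add, show K + 1 + (2 * K - 1) = 3 * K by omega, abs_mul,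
    abs_of_pos (by positivity : (0 : ℝ) < (4 / 9) ^ (3 * K))]
  calc |t| * (4 / 9) ^ (3 * K) ≤ 9 ^ K / 4 * (4 / 9) ^ (3 * K) := by gcongr; exact ht.2
    _ = (64 / 81) ^ K / 4 := by
      rw [pow_mul, div_mul_eq_mul_div, ← mul_pow]
      norm_num
    _ ≤ 1 / 4 := by
      gcongr
      exact pow_le_one₀ (by norm_num) (by norm_num)
    _ < 1 / 2 := by norm_num

end FirstExample

section Antichains

/-- The number of levels `i` in `(X, K]` at which `2 * t / 9 ^ i` is far from the integers. -/
def levelFarCount (X K : ℕ) (t : ℝ) : ℕ :=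
  open Classical in ((Finset.Ioc X K).filter fun i => Far (2 * t / 9 ^ i)).card

theorem levelFarCount_lt {X K K' k : ℕ} {s t : ℝ} (hXK : X ≤ K) (hK : K < K') (hk : K < k)
    (ht : InLayer K' t) (hz : levelMask pA DA k (t - s) = 0) :
    levelFarCount X K s < levelFarCount X K' t := by
  classical
  obtain ⟨j, -, hj⟩ := exists_eq_of_levelMask_A_eq_zero hz
  have hfar {i : ℕ} (hi : i ≤ K) (h : Far (2 * s / 9 ^ i)) : Far (2 * t / 9 ^ i) := by
    have hshift : 2 * t / 9 ^ i = 2 * s / 9 ^ i + ((3 * 9 ^ (k - i - 1) * j : ℤ) : ℝ) := by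
      have hpow : (9 : ℝ) ^ k = 9 ^ (k - i - 1) * 9 ^ i * 9 := by
        rw [← pow_add, ← pow_succ]
        congr 1
        omega
      rw [eq_add_of_sub_eq hj, hpow]
      push_cast
      field_simp
      ring
    rwa [hshift, far_add_intCast]
  rw [levelFarCount, levelFarCount]
  refine Finset.card_lt_card ((Finset.ssubset_iff_of_subset fun i hi => ?_).2 ⟨K', ?_, ?_⟩)
  · rw [Finset.mem_filter, Finset.mem_Ioc] at hi ⊢
    exact ⟨⟨hi.1.1, hi.1.2.trans hK.le⟩, hfar hi.1.2 hi.2⟩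
  · rw [Finset.mem_filter, Finset.mem_Ioc]
    exact ⟨⟨by omega, le_rfl⟩, ht.far⟩
  · rw [Finset.mem_filter, Finset.mem_Ioc]
    exact fun h => hK.not_ge h.1.2

theorem weightA_le_mul_rho_pow_levelFarCount {X K : ℕ} (hXK : X ≤ K) (t : ℝ) :
    weightA K t ≤ weightA X t * rho ^ levelFarCount X K t := by
  classical
  exact weightA_le_mul_rho_pow hXK (Finset.filter_subset _ _)
    fun k hk => Or.inl (Finset.mem_filter.1 hk).2

/-- The exponentials with frequencies in `T` are pairwise orthogonal for the first example: each
difference of frequencies is a zero of some mask. -/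
def OrthoA (T : Finset ℝ) : Prop :=
  ∀ s ∈ T, ∀ t ∈ T, s ≠ t → ∃ k, 1 ≤ k ∧ levelMask pA DA k (t - s) = 0

variable {T : Finset ℝ}

theorem OrthoA.subset (h : OrthoA T) {U : Finset ℝ} (hU : U ⊆ T) : OrthoA U :=
  fun s hs t ht => h s (hU hs) t (hU ht)

theorem OrthoA.sum_weightA_le_one_of_level_le (hT : OrthoA T) {K : ℝ → ℕ}
    (hK : ∀ s ∈ T, ∀ t ∈ T, ∀ k, levelMask pA DA k (t - s) = 0 → k ≤ K s) :
    ∑ t ∈ T, weightA (K t) t ≤ 1 := by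
  refine sum_prod_levelMask_le_one (fun n _ => nonempty_DA n) fun s hs t ht hst => ?_
  obtain ⟨k, hk, hz⟩ := hT s hs t ht hst
  have hz' : levelMask pA DA k (s - t) = 0 := by
    rw [← norm_eq_zero, ← neg_sub, norm_levelMask_neg, hz, norm_zero]
  exact ⟨k, hk, hK s hs t ht k hz, hK t ht s hs k hz', hz⟩

/-- If `k` exceeds the layer of `s`, then a zero of level `k` makes `s` and `t` congruent at all
levels of `s`, so that `t` has a further far level in its own layer. -/
theorem OrthoA.sum_weightA_le_one_of_levelFarCount (hT : OrthoA T) {X d : ℕ} {lay : ℝ → ℕ}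
    (hlay : ∀ t ∈ T, InLayer (lay t) t) (hX : ∀ t ∈ T, X ≤ lay t)
    (hd : ∀ t ∈ T, levelFarCount X (lay t) t = d) : ∑ t ∈ T, weightA (lay t) t ≤ 1 := by
  refine hT.sum_weightA_le_one_of_level_le fun s hs t ht k hz => ?_
  rcases lt_or_ge (lay s) (lay t) with h | h
  · by_contra! hk
    have hlt := levelFarCount_lt (hX s hs) h hk (hlay t ht) hz
    rw [hd s hs, hd t ht] at hlt
    exact hlt.false
  · refine le_of_levelMask_A_eq_zero hz ((abs_sub t s).trans_lt ?_)
    have hpow : (9 : ℝ) ^ lay t ≤ 9 ^ lay s := pow_le_pow_right₀ (by norm_num) h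
    rw [pow_succ]
    linarith [(hlay s hs).2, (hlay t ht).2, pow_pos (by norm_num : (0 : ℝ) < 9) (lay s)]

theorem OrthoA.sum_weightA_le_one_of_inLayer (hT : OrthoA T) {K : ℕ}
    (hK : ∀ t ∈ T, InLayer K t) : ∑ t ∈ T, weightA K t ≤ 1 :=
  hT.sum_weightA_le_one_of_level_le fun s hs t ht _ hz => (hK s hs).level_le (hK t ht) hz

theorem abs_sub_le_of_round_eq {c s t : ℝ} (hc : 0 < c) (h : round (s * c) = round (t * c)) :
    |t - s| ≤ c⁻¹ := by
  have hs := abs_le.1 (abs_sub_round (s * c))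
  have ht := abs_le.1 (abs_sub_round (t * c))
  rw [h] at hs
  have habs : |t - s| * c = |t * c - s * c| := by rw [← sub_mul, abs_mul, abs_of_pos hc]
  rw [inv_eq_one_div, le_div_iff₀ hc, habs, abs_le]
  constructor <;> linarith [hs.1, hs.2, ht.1, ht.2]

theorem nine_quarters_pow_lt {X K : ℕ} (hX : 1 ≤ X) (hK : K ≤ 2 * X) :
    (9 / 4 : ℝ) ^ (K + 1) < 9 ^ (X + 1) / 6 := by
  calc (9 / 4 : ℝ) ^ (K + 1) ≤ (9 / 4) ^ (2 * X + 1) :=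
        pow_le_pow_right₀ (by norm_num) (by omega)
    _ = (81 / 16) ^ X * (9 / 4) := by
        rw [pow_succ, pow_mul]
        norm_num
    _ ≤ 9 ^ X * (9 / 16) * (9 / 4) := by
        obtain ⟨Y, rfl⟩ := Nat.exists_eq_add_of_le' hX
        have hY : (81 / 16 : ℝ) ^ Y ≤ 9 ^ Y := pow_le_pow_left₀ (by norm_num) (by norm_num) _
        rw [pow_succ, pow_succ]
        linarith
    _ < 9 ^ (X + 1) / 6 := by
        rw [pow_succ]
        linarith [pow_pos (by norm_num : (0 : ℝ) < 9) X]

theorem OrthoA.sum_weightA_le_one_of_round_eq (hT : OrthoA T) {X K : ℕ} (hX : 1 ≤ X)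
    (hK : K ≤ 2 * X) {m : ℤ} (hm : ∀ t ∈ T, round (t * (4 / 9) ^ (K + 1)) = m) :
    ∑ t ∈ T, weightA X t ≤ 1 := by
  refine hT.sum_weightA_le_one_of_level_le fun s hs t ht k hz =>
    le_of_levelMask_A_eq_zero hz (lt_of_le_of_lt ?_ (nine_quarters_pow_lt hX hK))
  have h := abs_sub_le_of_round_eq (by positivity) ((hm s hs).trans (hm t ht).symm)
  rwa [← inv_pow, inv_div] at h

end Antichains

section DyadicRange

theorem sum_le_card_mul_of_fiber_sum_le {ι κ : Type*} [DecidableEq κ] {T : Finset ι}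
    {S : Finset κ} {g : ι → κ} (hg : ∀ t ∈ T, g t ∈ S) {f : ι → ℝ} {c : ℝ}
    (h : ∀ k ∈ S, ∑ t ∈ T with g t = k, f t ≤ c) : ∑ t ∈ T, f t ≤ S.card * c := by
  rw [← Finset.sum_fiberwise_of_maps_to hg]
  exact (Finset.sum_le_card_nsmul _ _ _ h).trans (by rw [nsmul_eq_mul])

variable {T : Finset ℝ} {F : ℝ → ℝ} {X K b b₀ J : ℕ}

theorem sum_le_rho_pow {L : ℝ → ℕ} (hsum : ∑ t ∈ T, weightA (L t) t ≤ 1)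
    (hF : ∀ t ∈ T, ∃ c, b ≤ c ∧ F t ≤ weightA (L t) t * rho ^ c) : ∑ t ∈ T, F t ≤ rho ^ b := by
  calc ∑ t ∈ T, F t ≤ ∑ t ∈ T, weightA (L t) t * rho ^ b := by
        refine Finset.sum_le_sum fun t ht => ?_
        obtain ⟨c, hc, hFc⟩ := hF t ht
        exact hFc.trans (mul_le_mul_of_nonneg_left
          (pow_le_pow_of_le_one rho_pos.le rho_lt_one.le hc) (weightA_nonneg _ _))
    _ ≤ 1 * rho ^ b := by
        rw [← Finset.sum_mul]
        exact mul_le_mul_of_nonneg_right hsum (pow_pos rho_pos _).le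
    _ = rho ^ b := one_mul _

theorem OrthoA.sum_le_of_levelFarCount_lt (hT : OrthoA T) (hF : ∀ t n, F t ≤ weightA n t)
    {lay : ℝ → ℕ} (hlay : ∀ t ∈ T, InLayer (lay t) t) (hX : ∀ t ∈ T, X ≤ lay t)
    (hb₀ : 6 * 2 ^ b₀ ≤ X) (hJ : ∀ t ∈ T, levelFarCount X (lay t) t < J) :
    ∑ t ∈ T, F t ≤ J * rho ^ b₀ := by
  rw [← Finset.card_range J]
  refine sum_le_card_mul_of_fiber_sum_le (g := fun t => levelFarCount X (lay t) t)
    (fun t ht => Finset.mem_range.2 (hJ t ht)) fun d _ => ?_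
  have hmem (t : ℝ) (ht : t ∈ T.filter fun t => levelFarCount X (lay t) t = d) : t ∈ T :=
    (Finset.mem_filter.1 ht).1
  refine sum_le_rho_pow ((hT.subset hmem).sum_weightA_le_one_of_levelFarCount
    (fun t ht => hlay t (hmem t ht)) (fun t ht => hX t (hmem t ht))
    fun t ht => (Finset.mem_filter.1 ht).2) fun t ht => ?_
  obtain ⟨n, hn⟩ := (hlay t (hmem t ht)).exists_le_orbitFarCount
    (hb₀.trans (hX t (hmem t ht)))
  exact ⟨_, hn, (hF t _).trans (weightA_le_mul_rho_pow_orbitFarCount _ n t)⟩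

theorem OrthoA.sum_le_of_le_orbitFarCount (hT : OrthoA T) (hF : ∀ t n, F t ≤ weightA n t)
    (hK : ∀ t ∈ T, InLayer K t)
    (hb : ∀ t ∈ T, b ≤ orbitFarCount (2 * K) (t * (4 / 9) ^ (K + 1))) :
    ∑ t ∈ T, F t ≤ rho ^ b :=
  sum_le_rho_pow (hT.sum_weightA_le_one_of_inLayer hK) fun t ht =>
    ⟨_, hb t ht, (hF t _).trans (weightA_le_mul_rho_pow_orbitFarCount K (2 * K) t)⟩

theorem OrthoA.sum_le_of_orbitFarCount_lt (hT : OrthoA T) (hF : ∀ t n, F t ≤ weightA n t)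
    (hX : 1 ≤ X) (hXK : K ∈ Finset.Ioc X (2 * X)) (hK : ∀ t ∈ T, InLayer K t)
    (hb : ∀ t ∈ T, orbitFarCount (2 * K) (t * (4 / 9) ^ (K + 1)) ≤ b)
    (hJ : ∀ t ∈ T, J ≤ levelFarCount X K t) :
    ∑ t ∈ T, F t ≤ (48 * X) ^ (2 * b) * rho ^ J := by
  obtain ⟨hXK, hKX⟩ := Finset.mem_Ioc.1 hXK
  have hcard : ((startValues 9 4 6 0 (2 * K - 1) (2 * b)).card : ℝ) ≤ (48 * X) ^ (2 * b) := by
    exact_mod_cast (card_startValues_le 9 4 6 0 (2 * K - 1) (2 * b)).trans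
      (Nat.pow_le_pow_left (by omega) _)
  refine (sum_le_card_mul_of_fiber_sum_le (g := fun t => round (t * (4 / 9) ^ (K + 1)))
    (fun t ht => (hK t ht).round_mem_startValues (by omega) (hb t ht)) fun m _ => ?_).trans
    (mul_le_mul_of_nonneg_right hcard (pow_pos rho_pos J).le)
  refine sum_le_rho_pow ((hT.subset (Finset.filter_subset _ _)).sum_weightA_le_one_of_round_eq
    hX hKX fun t ht => (Finset.mem_filter.1 ht).2) fun t ht => ?_
  exact ⟨_, hJ t (Finset.mem_filter.1 ht).1,
    (hF t K).trans (weightA_le_mul_rho_pow_levelFarCount hXK.le t)⟩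

theorem OrthoA.sum_le_of_mem_Ioc (hT : OrthoA T) (hF : ∀ t n, F t ≤ weightA n t)
    (hX : 1 ≤ X) (hb₀ : 6 * 2 ^ b₀ ≤ X) {lay : ℝ → ℕ} (hlay : ∀ t ∈ T, InLayer (lay t) t)
    (hlayX : ∀ t ∈ T, lay t ∈ Finset.Ioc X (2 * X)) :
    ∑ t ∈ T, F t ≤ J * rho ^ b₀ + X * (rho ^ b + (48 * X) ^ (2 * b) * rho ^ J) := by
  have hXlay (t : ℝ) (ht : t ∈ T) : X ≤ lay t := (Finset.mem_Ioc.1 (hlayX t ht)).1.le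
  have hcard : (Finset.Ioc X (2 * X)).card = X := by
    rw [Nat.card_Ioc]
    omega
  rw [← Finset.sum_filter_add_sum_filter_not T fun t => levelFarCount X (lay t) t < J]
  refine add_le_add ?_ ?_
  · refine (hT.subset (Finset.filter_subset _ _)).sum_le_of_levelFarCount_lt hF
      (fun t ht => hlay t (Finset.mem_filter.1 ht).1)
      (fun t ht => hXlay t (Finset.mem_filter.1 ht).1) hb₀ fun t ht => (Finset.mem_filter.1 ht).2
  nth_rewrite 4 [← hcard]
  refine sum_le_card_mul_of_fiber_sum_le (g := lay)
    (fun t ht => hlayX t (Finset.mem_filter.1 ht).1) fun K hK => ?_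
  set U := (T.filter fun t => ¬ levelFarCount X (lay t) t < J).filter fun t => lay t = K with hU
  have hmem : ∀ t ∈ U, InLayer K t ∧ J ≤ levelFarCount X K t := by
    intro t ht
    simp only [hU, Finset.mem_filter, not_lt] at ht
    obtain ⟨⟨htT, hJ⟩, rfl⟩ := ht
    exact ⟨hlay t htT, hJ⟩
  have hUT : U ⊆ T := (Finset.filter_subset _ _).trans (Finset.filter_subset _ _)
  rw [← Finset.sum_filter_add_sum_filter_not U
    fun t => b ≤ orbitFarCount (2 * K) (t * (4 / 9) ^ (K + 1))]
  refine add_le_add ?_ ?_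
  · exact (hT.subset ((Finset.filter_subset _ _).trans hUT)).sum_le_of_le_orbitFarCount hF
      (fun t ht => (hmem t (Finset.mem_filter.1 ht).1).1) fun t ht => (Finset.mem_filter.1 ht).2
  · exact (hT.subset ((Finset.filter_subset _ _).trans hUT)).sum_le_of_orbitFarCount_lt hF hX hK
      (fun t ht => (hmem t (Finset.mem_filter.1 ht).1).1)
      (fun t ht => (not_le.1 (Finset.mem_filter.1 ht).2).le)
      fun t ht => (hmem t (Finset.mem_filter.1 ht).1).2

end DyadicRange

section FarMass

theorem rho_pow_mul_le (q : ℕ) : rho ^ (300 * q) ≤ (1 / 2) ^ (2 * q) := by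
  have h150 : rho ^ 150 ≤ 1 / 2 := by
    rw [rho]
    norm_num
  rw [show 300 * q = 150 * (2 * q) by ring, pow_mul]
  exact pow_le_pow_left₀ (pow_pos rho_pos 150).le h150 _

/-- A summable bound for the mass carried by the layers `K` with `2 ^ j < K ≤ 2 ^ (j + 1)`. -/
def dyadicBound (j : ℕ) : ℝ :=
  2000000 * ((j : ℝ) ^ 2 * rho ^ j) + 2 * (1 / 2) ^ j

theorem summable_dyadicBound : Summable dyadicBound := by
  refine Summable.add (Summable.mul_left _ ?_) (Summable.mul_left _ ?_)
  · refine summable_pow_mul_geometric_of_norm_lt_one 2 ?_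
    rw [Real.norm_of_nonneg rho_pos.le]
    exact rho_lt_one
  · exact summable_geometric_of_lt_one (by norm_num) (by norm_num)

theorem mul_rho_pow_le_sq_mul_rho_pow {j : ℕ} (hj : 3 ≤ j) :
    ((300 * (j + 300 * j * (j + 6)) : ℕ) : ℝ) * rho ^ (j - 3) ≤
      2000000 * ((j : ℝ) ^ 2 * rho ^ j) := by
  obtain ⟨i, rfl⟩ := Nat.exists_eq_add_of_le' hj
  rw [Nat.add_sub_cancel]
  generalize hj' : i + 3 = j at *
  have hj1 : (3 : ℝ) ≤ j := by exact_mod_cast hj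
  have hcoef : ((300 * (j + 300 * j * (j + 6)) : ℕ) : ℝ) ≤ 700000 * (j : ℝ) ^ 2 := by
    push_cast
    nlinarith
  have hrho : rho ^ i ≤ 3 / 2 * rho ^ j := by
    have h3 : 1 ≤ 3 / 2 * rho ^ 3 := by
      rw [rho]
      norm_num
    rw [← hj', pow_add, mul_left_comm]
    exact le_mul_of_one_le_right (pow_pos rho_pos i).le h3
  calc _ ≤ 700000 * (j : ℝ) ^ 2 * (3 / 2 * rho ^ j) :=
        mul_le_mul hcoef hrho (pow_pos rho_pos i).le (by positivity)
    _ ≤ 2000000 * ((j : ℝ) ^ 2 * rho ^ j) := by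
        linarith [mul_nonneg (sq_nonneg (j : ℝ)) (pow_pos rho_pos j).le]

theorem two_pow_mul_half_pow (j : ℕ) : (2 : ℝ) ^ j * (1 / 2) ^ (2 * j) = (1 / 2) ^ j := by
  rw [two_mul, pow_add, ← mul_assoc, ← mul_pow]
  norm_num

theorem pow_mul_rho_pow_le (j : ℕ) :
    (48 * (2 : ℝ) ^ j) ^ (2 * (300 * j)) * rho ^ (300 * (j + 300 * j * (j + 6))) ≤
      (1 / 2) ^ (2 * j) := by
  have hbase : (48 * (2 : ℝ) ^ j) ^ (2 * (300 * j)) ≤ 2 ^ (2 * (300 * j * (j + 6))) := by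
    have h48 : 48 * (2 : ℝ) ^ j ≤ 2 ^ (j + 6) := by
      rw [pow_add]
      linarith [pow_pos (by norm_num : (0 : ℝ) < 2) j]
    refine (pow_le_pow_left₀ (by positivity) h48 _).trans_eq ?_
    rw [← pow_mul]
    congr 1
    ring
  refine (mul_le_mul hbase (rho_pow_mul_le _) (pow_pos rho_pos _).le (by positivity)).trans_eq ?_
  generalize 300 * j * (j + 6) = q
  rw [mul_add 2 j, pow_add _ (2 * j), mul_left_comm, ← mul_pow]
  norm_num

variable {T : Finset ℝ} {F : ℝ → ℝ}

theorem OrthoA.sum_le_dyadicBound (hT : OrthoA T) (hF : ∀ t n, F t ≤ weightA n t) {j : ℕ}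
    (hj : 3 ≤ j) {lay : ℝ → ℕ} (hlay : ∀ t ∈ T, InLayer (lay t) t)
    (hlayj : ∀ t ∈ T, lay t ∈ Finset.Ioc (2 ^ j) (2 * 2 ^ j)) : ∑ t ∈ T, F t ≤ dyadicBound j := by
  have hb₀ : 6 * 2 ^ (j - 3) ≤ 2 ^ j := by
    rw [← Nat.sub_add_cancel hj, pow_add, Nat.add_sub_cancel]
    omega
  -- `J` is chosen so that `rho ^ J` beats the number `(48 * 2 ^ j) ^ (600 * j)` of starting values.
  refine (hT.sum_le_of_mem_Ioc (b := 300 * j) (J := 300 * (j + 300 * j * (j + 6))) hF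
    Nat.one_le_two_pow hb₀ hlay hlayj).trans ?_
  push_cast
  have hsmall : (2 : ℝ) ^ j * (rho ^ (300 * j) + (48 * 2 ^ j) ^ (2 * (300 * j)) *
      rho ^ (300 * (j + 300 * j * (j + 6)))) ≤ 2 * (1 / 2) ^ j := by
    refine (mul_le_mul_of_nonneg_left (add_le_add (rho_pow_mul_le j) (pow_mul_rho_pow_le j))
      (pow_pos two_pos j).le).trans_eq ?_
    rw [← two_mul, mul_left_comm, two_pow_mul_half_pow]
  have hmain := mul_rho_pow_le_sq_mul_rho_pow hj
  push_cast at hmain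
  exact add_le_add hmain hsmall

/-- The least `K` with `|t| ≤ 9 ^ K / 4`, the layer of `t` when it is positive. -/
def layerOf (t : ℝ) : ℕ := sInf {K : ℕ | |t| ≤ 9 ^ K / 4}

theorem abs_le_layerOf (t : ℝ) : |t| ≤ 9 ^ layerOf t / 4 := by
  obtain ⟨n, hn⟩ := pow_unbounded_of_one_lt (4 * |t|) (by norm_num : (1 : ℝ) < 9)
  refine Nat.sInf_mem (s := {K : ℕ | |t| ≤ 9 ^ K / 4}) ⟨n, ?_⟩
  rw [Set.mem_ofPred_eq]
  linarith

theorem lt_layerOf {A : ℕ} {t : ℝ} (h : 9 ^ A / 4 < |t|) : A < layerOf t := by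
  by_contra! hA
  have hpow : (9 : ℝ) ^ layerOf t ≤ 9 ^ A := pow_le_pow_right₀ (by norm_num) hA
  linarith [abs_le_layerOf t]

theorem inLayer_layerOf {t : ℝ} (h : 0 < layerOf t) : InLayer (layerOf t) t := by
  refine ⟨?_, abs_le_layerOf t⟩
  obtain ⟨n, hn⟩ := Nat.exists_eq_add_of_lt h
  have hlt : n < sInf {K : ℕ | |t| ≤ 9 ^ K / 4} := by
    change n < layerOf t
    omega
  have hnot := Nat.notMem_of_lt_sInf hlt
  rw [Set.mem_ofPred_eq, not_le] at hnot
  rw [hn, zero_add, pow_succ]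
  linarith

theorem mem_Ioc_two_pow_log {K : ℕ} (hK : 2 ≤ K) :
    K ∈ Finset.Ioc (2 ^ Nat.log 2 (K - 1)) (2 * 2 ^ Nat.log 2 (K - 1)) := by
  have hle := Nat.pow_log_le_self 2 (x := K - 1) (by omega)
  have hlt := Nat.lt_pow_succ_log_self (b := 2) (by norm_num) (K - 1)
  rw [Nat.pow_succ] at hlt
  rw [Finset.mem_Ioc]
  omega

theorem exists_far_mass_le : ∃ A : ℕ, ∀ (T : Finset ℝ) (F : ℝ → ℝ), OrthoA T →
    (∀ t n, F t ≤ weightA n t) → (∀ t ∈ T, 9 ^ A / 4 < |t|) → ∑ t ∈ T, F t ≤ 1 / 2 := by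
  obtain ⟨S, hS⟩ := summable_iff_vanishing_norm.1 summable_dyadicBound (1 / 2) (by norm_num)
  obtain ⟨n, hn⟩ := S.exists_nat_subset_range
  refine ⟨2 ^ (n + 3), fun T F hT hF hA => ?_⟩
  set g : ℝ → ℕ := fun t => Nat.log 2 (layerOf t - 1)
  have hlt (t : ℝ) (ht : t ∈ T) : 2 ^ (n + 3) < layerOf t := lt_layerOf (hA t ht)
  have htwo (t : ℝ) (ht : t ∈ T) : 2 ≤ layerOf t := Nat.one_le_two_pow.trans_lt (hlt t ht)
  have hgn (t : ℝ) (ht : t ∈ T) : n + 3 ≤ g t :=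
    Nat.le_log_of_pow_le (by norm_num) (Nat.le_sub_one_of_lt (hlt t ht))
  have hfiber : ∀ j ∈ T.image g, ∑ t ∈ T with g t = j, F t ≤ dyadicBound j := by
    intro j hj
    obtain ⟨s, hs, rfl⟩ := Finset.mem_image.1 hj
    have hmem (t : ℝ) (ht : t ∈ T.filter fun t => g t = g s) : t ∈ T := (Finset.mem_filter.1 ht).1
    refine (hT.subset hmem).sum_le_dyadicBound hF ((Nat.le_add_left 3 n).trans (hgn s hs))
      (fun t ht => inLayer_layerOf (two_pos.trans_le (htwo t (hmem t ht)))) fun t ht => ?_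
    rw [← (Finset.mem_filter.1 ht).2]
    exact mem_Ioc_two_pow_log (htwo t (hmem t ht))
  have hdisj : Disjoint (T.image g) S := by
    rw [Finset.disjoint_left]
    intro j hj hjS
    obtain ⟨t, ht, rfl⟩ := Finset.mem_image.1 hj
    have hltn := Finset.mem_range.1 (hn hjS)
    linarith [hgn t ht]
  calc ∑ t ∈ T, F t = ∑ j ∈ T.image g, ∑ t ∈ T with g t = j, F t :=
        (Finset.sum_fiberwise_of_maps_to (fun t ht => Finset.mem_image_of_mem g ht) F).symm
    _ ≤ ∑ j ∈ T.image g, dyadicBound j := Finset.sum_le_sum hfiber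
    _ ≤ 1 / 2 := (le_abs_self _).trans (hS _ hdisj).le

end FarMass

section Gaps

theorem exists_finset_card_eq_of_forall_near {Λ : Set ℝ} {R : ℝ} (hR : 0 ≤ R)
    (hΛ : ∀ x, ∃ t ∈ Λ, |t - x| ≤ R) (M : ℕ) :
    ∃ T : Finset ℝ, (T : Set ℝ) ⊆ Λ ∧ T.card = M + 1 ∧
      ∀ s ∈ T, ∀ t ∈ T, |t - s| ≤ (3 * R + 1) * (M + 1) := by
  choose f hfΛ hf using hΛ
  set g : ℕ → ℝ := fun i => f ((3 * R + 1) * i)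
  have hdist (i j : ℕ) : |(g j - g i) - (3 * R + 1) * ((j : ℝ) - i)| ≤ 2 * R := by
    have hi := abs_le.1 (hf ((3 * R + 1) * i))
    have hj := abs_le.1 (hf ((3 * R + 1) * j))
    rw [abs_le]
    constructor <;> linarith [hi.1, hi.2, hj.1, hj.2]
  have hinj : Function.Injective g := by
    intro i j hij
    by_contra hne
    have h := hdist i j
    have hone : (1 : ℝ) ≤ |(j : ℝ) - i| := by
      have : (1 : ℤ) ≤ |(j : ℤ) - i| := Int.one_le_abs (by omega)
      exact_mod_cast this
    rw [hij, sub_self, zero_sub, abs_neg, abs_mul, abs_of_pos (by positivity)] at h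
    linarith [mul_le_mul_of_nonneg_left hone (by positivity : 0 ≤ 3 * R + 1)]
  refine ⟨(Finset.range (M + 1)).map ⟨g, hinj⟩, ?_, by rw [Finset.card_map, Finset.card_range], ?_⟩
  · simp only [Finset.coe_map, Set.image_subset_iff]
    exact fun i _ => hfΛ _
  · simp only [Finset.forall_mem_map, Finset.mem_range, Function.Embedding.coeFn_mk]
    intro i hi j hj
    have hij : |(j : ℝ) - i| ≤ M := by
      have : |(j : ℤ) - i| ≤ M := by
        rw [abs_le]
        omega
      exact_mod_cast this
    calc |g j - g i| ≤ 2 * R + |(3 * R + 1) * ((j : ℝ) - i)| := by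
          linarith [abs_sub_abs_le_abs_sub (g j - g i) ((3 * R + 1) * ((j : ℝ) - i)), hdist i j]
      _ ≤ (3 * R + 1) * (M + 1) := by
          rw [abs_mul, abs_of_pos (by positivity)]
          linarith [mul_le_mul_of_nonneg_left hij (by positivity : 0 ≤ 3 * R + 1)]

theorem OrthoA.card_le {T : Finset ℝ} (hT : OrthoA T) {N : ℕ}
    (hN : ∀ s ∈ T, ∀ t ∈ T, |t - s| < 9 ^ (N + 1) / 6) : T.card ≤ 3 ^ N := by
  have hcard : T.card ≤ ∏ k ∈ Finset.Icc 1 N, (DA k).card :=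
    card_le_prod_card_of_levelMask (fun n _ => nonempty_DA n) fun s hs t ht hst => by
      obtain ⟨k, hk, hz⟩ := hT s hs t ht hst
      exact ⟨k, hk, le_of_levelMask_A_eq_zero hz (hN s hs t ht), hz⟩
  refine hcard.trans ((Finset.prod_le_pow_card _ _ 3 fun k _ => Finset.card_le_three).trans_eq ?_)
  rw [Nat.card_Icc, Nat.add_sub_cancel]

theorem exists_gap {Λ : Set ℝ} (hΛ : ∀ T : Finset ℝ, (T : Set ℝ) ⊆ Λ → OrthoA T) {R : ℝ}
    (hR : 0 ≤ R) : ∃ x : ℝ, ∀ t ∈ Λ, R < |t - x| := by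
  by_contra! hnear
  obtain ⟨N, hN⟩ := pow_unbounded_of_one_lt (2 * (3 * R + 1)) (by norm_num : (1 : ℝ) < 3)
  obtain ⟨T, hTΛ, hcard, hdist⟩ := exists_finset_card_eq_of_forall_near hR hnear (3 ^ N)
  have hle := (hΛ T hTΛ).card_le (N := N) fun s hs t ht => (hdist s hs t ht).trans_lt <| by
    have hone : (1 : ℝ) ≤ 3 ^ N := one_le_pow₀ (by norm_num)
    have hnine : (9 : ℝ) ^ (N + 1) / 6 = 3 / 2 * (3 ^ N * 3 ^ N) := by
      rw [pow_succ, ← mul_pow]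
      norm_num
      ring
    rw [hnine]
    push_cast
    linarith [mul_lt_mul_of_pos_right hN (by positivity : (0 : ℝ) < 3 ^ N),
      le_mul_of_one_le_right (by positivity : 0 ≤ 3 * R + 1) hone,
      mul_pos (by positivity : (0 : ℝ) < 3 ^ N) (by positivity : (0 : ℝ) < 3 ^ N)]
  omega

end Gaps

section NotSpectral

theorem abs_le_of_mem_DA {k : ℕ} {d : ℤ} (hd : d ∈ DA k) : |(d : ℝ)| ≤ 2 * 4 ^ k := by
  have hone : (1 : ℝ) ≤ 4 ^ k := one_le_pow₀ (by norm_num)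
  simp only [DA, Finset.mem_insert, Finset.mem_singleton] at hd
  rcases hd with rfl | rfl | rfl
  · simp
  · rw [Int.cast_ofNat, abs_two]
    linarith
  · push_cast
    rw [abs_of_pos (by positivity)]
    linarith

theorem summable_norm_levelMask_A_sub_one (t : ℝ) :
    Summable fun k => ‖levelMask pA DA k t - 1‖ := by
  have hgeom : Summable fun k : ℕ => (4 / 9 : ℝ) ^ k :=
    summable_geometric_of_lt_one (by norm_num) (by norm_num)
  refine Summable.of_nonneg_of_le (fun k => norm_nonneg _) (fun k => ?_)
    (hgeom.mul_left (4 * Real.pi * |t|))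
  refine (norm_mask_sub_one_le (c := 2 * 4 ^ k * (|t| / 9 ^ k)) (nonempty_DA k)
    fun d hd => ?_).trans_eq ?_
  · rw [moranProd_pA, abs_mul, abs_div]
    push_cast
    rw [abs_of_pos (by positivity : (0 : ℝ) < 9 ^ k)]
    exact mul_le_mul_of_nonneg_right (abs_le_of_mem_DA hd) (by positivity)
  · rw [div_pow]
    ring

theorem not_isSpectralMeasure_of_isMoranMeasure_A {μ : ProbabilityMeasure ℝ}
    (hμ : IsMoranMeasure pA DA μ) : ¬ IsSpectralMeasure μ := by
  rintro ⟨Λ, hΛ⟩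
  have hzero (s t : ℝ) (hs : s ∈ Λ) (ht : t ∈ Λ) (hst : s ≠ t) :
      ∃ k, 1 ≤ k ∧ levelMask pA DA k (t - s) = 0 :=
    hμ.exists_levelMask_eq_zero (fun n _ => pA_ne_zero n) (fun n _ => nonempty_DA n)
      (summable_norm_levelMask_A_sub_one _) (hΛ.ft_sub_eq_zero hs ht hst)
  obtain ⟨A, hA⟩ := exists_far_mass_le
  obtain ⟨x, hx⟩ := exists_gap (fun T hT s hs t ht => hzero s t (hT hs) (hT ht))
    (by positivity : (0 : ℝ) ≤ 9 ^ A / 4)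
  have hhalf (S : Finset Λ) : ∑ t ∈ S, ‖ft (μ : Measure ℝ) (-x + t)‖ ^ 2 ≤ 1 / 2 := by
    set e : Λ ↪ ℝ := ⟨fun t => -x + t, fun s t h => Subtype.ext (add_left_cancel h)⟩
    refine (Finset.sum_map S e fun t => ‖ft (μ : Measure ℝ) t‖ ^ 2).symm.trans_le
      (hA _ _ ?_ (fun t n => ?_) ?_)
    · simp only [OrthoA, Finset.forall_mem_map]
      intro s _ t _ hst
      rw [show e t - e s = t - s from add_sub_add_left_eq_sub _ _ _]
      exact hzero s t s.2 t.2 fun h => hst (by rw [Subtype.ext h])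
    · rw [weightA, Finset.prod_pow]
      exact pow_le_pow_left₀ (norm_nonneg _)
        (hμ.norm_ft_le_prod (fun n _ => pA_ne_zero n) (fun n _ => nonempty_DA n) t n) 2
    · simp only [Finset.forall_mem_map]
      intro t _
      exact (hx t t.2).trans_eq (by rw [sub_eq_neg_add]; rfl)
  have hone := hasSum_le_of_sum_le (hΛ.hasSum (-x)) hhalf
  norm_num at hone

end NotSpectral

section Examples

theorem isHadamardTriple_A (n : ℕ) :
    IsHadamardTriple (pA n) (DA n) ((Finset.range 3).image fun c : ℕ => 3 * (c : ℤ)) := by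
  have hmod : (4 : ℤ) ^ n % 3 = 1 := by
    rw [Int.ModEq.pow n (show (4 : ℤ) ≡ 1 [ZMOD 3] from rfl), one_pow]
    rfl
  have hne := two_ne_four_pow n
  refine isHadamardTriple_of_not_dvd (N := 3) (r := 3) (by norm_num) ?_ ?_
  · exact Finset.card_eq_three.2 ⟨0, 2, 4 ^ n, by norm_num, by omega, hne, rfl⟩
  · intro d hd d' hd' hdd'
    simp only [DA, Finset.mem_insert, Finset.mem_singleton] at hd hd'
    rcases hd with rfl | rfl | rfl <;> rcases hd' with rfl | rfl | rfl <;> omega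

theorem isHadamardSequence_A : IsHadamardSequence pA DA :=
  ⟨⟨_, fun n _ => isHadamardTriple_A n⟩, 3, fun _ _ => Finset.card_le_three⟩

theorem isHadamardSequence_B : IsHadamardSequence pB DB :=
  ⟨⟨_, fun _ hn => isHadamardTriple_B hn⟩, 3, fun _ _ => Finset.card_le_three⟩

theorem not_boundedDigits_A : ¬ BoundedDigits pA DA := by
  rintro ⟨C, hC⟩
  obtain ⟨n, hn⟩ := pow_unbounded_of_one_lt (9 * C) (by norm_num : (1 : ℝ) < 4)
  have h := hC ⟨n + 1, Nat.le_add_left 1 n, 4 ^ (n + 1), by simp [DA], rfl⟩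
  rw [pA] at h
  push_cast at h
  rw [div_le_iff₀ (by norm_num), pow_succ] at h
  linarith [pow_pos (by norm_num : (0 : ℝ) < 4) n]

theorem not_boundedDigits_B : ¬ BoundedDigits pB DB := by
  rintro ⟨C, hC⟩
  obtain ⟨n, hn⟩ := exists_nat_gt C
  have h := hC ⟨n + 1, Nat.le_add_left 1 n, 3 * ((n + 1 : ℕ) : ℤ) ^ 2 + 1, by simp [DB], rfl⟩
  rw [pB] at h
  push_cast at h
  rw [div_le_iff₀ (by positivity)] at h
  nlinarith [Nat.cast_nonneg (α := ℝ) n]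

theorem exists_isMoranMeasure_A : ∃ μ, IsMoranMeasure pA DA μ := by
  have hgeom : Summable fun n : ℕ => 2 * (4 / 9 : ℝ) ^ n :=
    (summable_geometric_of_lt_one (by norm_num) (by norm_num)).mul_left 2
  refine exists_isMoranMeasure (fun n _ => nonempty_DA n) ((summable_nat_add_iff 1).2 hgeom)
    fun n x hx => ?_
  rw [scaledDigits_eq_image] at hx
  obtain ⟨d, hd, rfl⟩ := Finset.mem_image.1 hx
  rw [moranProd_pA, abs_div, div_pow, ← mul_div_assoc]
  push_cast
  rw [abs_of_pos (by positivity : (0 : ℝ) < 9 ^ (n + 1))]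
  exact div_le_div_of_nonneg_right (abs_le_of_mem_DA hd) (by positivity)

theorem exists_isMoranMeasure_B : ∃ μ, IsMoranMeasure pB DB μ := by
  have hsum : Summable fun n : ℕ => 4 * ((n : ℝ) ^ 2 * (1 / 3) ^ n) :=
    (summable_pow_mul_geometric_of_norm_lt_one 2
      (by norm_num : ‖(1 / 3 : ℝ)‖ < 1)).mul_left 4
  refine exists_isMoranMeasure (fun n _ => nonempty_DB n) ((summable_nat_add_iff 1).2 hsum)
    fun n x hx => ?_
  rw [scaledDigits_eq_image] at hx
  obtain ⟨d, hd, rfl⟩ := Finset.mem_image.1 hx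
  have hpow := three_pow_mul_moranProd_pB_le 0 (n + 1)
  rw [zero_add, show moranProd pB 0 = 1 from rfl, Int.cast_one, mul_one] at hpow
  rw [abs_div, abs_of_pos (moranProd_pB_pos _), one_div_pow, ← mul_assoc, mul_one_div]
  exact div_le_div₀ (by positivity) (abs_le_of_mem_DB (Nat.le_add_left 1 n) hd) (by positivity)
    hpow

end Examples

end CantorMoran

end

theorem mainTheorem5 :
    (CantorMoran.IsHadamardSequence CantorMoran.pA CantorMoran.DA ∧
      ¬ CantorMoran.BoundedDigits CantorMoran.pA CantorMoran.DA ∧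
      (∃ μ : ProbabilityMeasure ℝ, CantorMoran.IsMoranMeasure CantorMoran.pA CantorMoran.DA μ) ∧
      ∀ μ : ProbabilityMeasure ℝ, CantorMoran.IsMoranMeasure CantorMoran.pA CantorMoran.DA μ →
        ¬ CantorMoran.IsSpectralMeasure μ) ∧
    (CantorMoran.IsHadamardSequence CantorMoran.pB CantorMoran.DB ∧
      ¬ CantorMoran.BoundedDigits CantorMoran.pB CantorMoran.DB ∧
      (∃ μ : ProbabilityMeasure ℝ, CantorMoran.IsMoranMeasure CantorMoran.pB CantorMoran.DB μ) ∧
      ∀ μ : ProbabilityMeasure ℝ, CantorMoran.IsMoranMeasure CantorMoran.pB CantorMoran.DB μ →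
        CantorMoran.IsSpectralMeasure μ) :=
  ⟨⟨CantorMoran.isHadamardSequence_A, CantorMoran.not_boundedDigits_A,
      CantorMoran.exists_isMoranMeasure_A,
      fun _ => CantorMoran.not_isSpectralMeasure_of_isMoranMeasure_A⟩,
    CantorMoran.isHadamardSequence_B, CantorMoran.not_boundedDigits_B,
    CantorMoran.exists_isMoranMeasure_B,
    fun _ => CantorMoran.isSpectralMeasure_of_isMoranMeasure_B⟩
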